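/- Let $E$ be a smooth manifold of dimension $n+m$ with a torsion-free linear connection $\Gamma$ on $TE$, let $M$ be a smooth manifold of dimension $n$ with a torsion-free linear connection $\Theta$ on $TM$, and let $\mathrm{pr}_M\colon M\times E\to M$ be the projection. Let $J^r(E,n)$ be the space of $r$-jets $[L]^r_p$ of $n$-dimensional embedded submanifolds $L\ni p$ of $E$, let $J^r\mathrm{pr}_M$ be the bundle of $r$-jets $[s]^r_x$ of local sections of $\mathrm{pr}_M$ (that is, of smooth maps $s\colon U\subseteq M\to E$), and let $\mathrm{Imm}\,J^r\mathrm{pr}_M\subseteq J^r\mathrm{pr}_M$ be the subset of jets of immersions. The $r$-prolongation $\mathrm{pr}_E^{(r)}\colon \mathrm{Imm}\,J^r\mathrm{pr}_M\to J^r(E,n)$ sends $[s]^r_x$ to $[s(U)]^r_{s(x)}$, where $U$ is a small neighbourhood of $x$. Let $\dot\Gamma$ be the connection on $J^1(E,n)\to E$ whose vertical projection assigns to a tangent vector $\xi$ of $J^1(E,n)$ at $[L]^1_p$ the homomorphism $T_pL\to T_pE/T_pL$, $w\mapsto [\nabla_{\xi}W]$, where $W$ extends $w$ to a section of the tautological bundle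 of $n$-planes and $\nabla$ is induced by $\Gamma$. In coordinates $(u^\lambda,u^i,u^i_\lambda)$, $$\dot\Gamma_A{}^k{}_\xi=\Gamma_A{}^k{}_\xi+\Gamma_A{}^k{}_i\,u^i_\xi-u^k_\beta\left(\Gamma_A{}^\beta{}_\xi+\Gamma_A{}^\beta{}_i\,u^i_\xi\right).$$ Let $\ddot\Gamma\colon J^1(E,n)\to J^2(E,n)$ be the section such that $\ddot\Gamma(\theta)$ is the unique 2-jet $[L]^2_p$ over $\theta=[L]^1_p$ for which the tangent plane at $\theta$ of $L^{(1)}=\{[L]^1_q: q\in L\}$ is $\dot\Gamma$-horizontal. Similarly, let $\dot\Gamma_{\mathrm{pr}_M}=\mathrm{pr}_E^*(\Gamma)\otimes \mathrm{pr}_M^*(\Theta^*)$, a connection on $J^1\mathrm{pr}_M\cong \mathrm{pr}_E^*(TE)\otimes \mathrm{pr}_M^*(T^*M)\to M\times E$, and let $\ddot\Gamma_{\mathrm{pr}_M}\colon J^1\mathrm{pr}_M\to J^2\mathrm{pr}_M$ be the section such that $\ddot\Gamma_{\mathrm{pr}_M}(\tilde\theta)$ is the unique 2-jet $[s]^2_x$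 over $\tilde\theta=[s]^1_x$ for which the tangent plane at $\tilde\theta$ of $\{[s]^1_y\}$ is $\dot\Gamma_{\mathrm{pr}_M}$-horizontal; in charts, $$u^C_{x^\xi x^\lambda}+\Gamma_A{}^C{}_B\,u^A_{x^\xi}u^B_{x^\lambda}-\Theta_\xi{}^\eta{}_\lambda\,u^C_{x^\eta}=0.$$ Then $\ddot\Gamma_{\mathrm{pr}_M}$ maps $\mathrm{Imm}\,J^1\mathrm{pr}_M$ into $\mathrm{Imm}\,J^2\mathrm{pr}_M$, and $$\mathrm{pr}_E^{(2)}\circ\ddot\Gamma_{\mathrm{pr}_M}=\ddot\Gamma\circ\mathrm{pr}_E^{(1)}\qquad\text{on } \mathrm{Imm}\,J^1\mathrm{pr}_M .$$ In particular $\mathrm{pr}_E^{(2)}$ maps the equation of parametrized totally geodesic submanifolds $\mathcal S_{\mathrm{pr}_M}\subseteq\mathrm{Imm}\,J^2\mathrm{pr}_M$ (the jets with $\mathrm{II}_{\mathrm{pr}_M}=0$, i.e. satisfying the last displayed equation) into the equation of unparametrized totally geodesic submanifolds $\mathcal S\subseteq J^2(E,n)$ (the jets $[L]^2_p$ for which the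 second fundamental form $\mathrm{II}(X,Y)=[\nabla_X Y]\in T_pE/T_pL$ of $L$ at $p$ vanishes). -/

import Mathlib

open Set Filter Topology Manifold
open scoped ContDiff

namespace JetSubmfd

/-- The coordinate space `ℝᵏ`. -/
abbrev Eu (k : ℕ) : Type := EuclideanSpace ℝ (Fin k)

/-- A smooth torsion-free linear connection on the tangent bundle of a smooth `k`-manifold `N`. -/
structure TorsionFreeConnection (k : ℕ) (N : Type*) [TopologicalSpace N] [ChartedSpace (Eu k) N]
    [IsManifold (𝓡 k) ∞ N] where
  cov : CovariantDerivative (𝓡 k) (Eu k) (TangentSpace (𝓡 k) : N → Type _)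
  smooth : cov.ContMDiffCovariantDerivative ∞
  torsion_eq_zero : cov.torsion = 0

section Connection

variable {k : ℕ} {N : Type*} [TopologicalSpace N] [ChartedSpace (Eu k) N]
  {F : Type*} [NormedAddCommGroup F] [NormedSpace ℝ F]

/-- The vector field on `N` with constant components `w` in the coordinates `e`
(that is `∑ wⁱ ∂ᵢ`), as a field defined near every point at which `e` is a chart. -/
noncomputable def coordField (e : N → F) (w : F) (q : N) : TangentSpace (𝓡 k) q :=
  VectorField.mpullback (𝓡 k) 𝓘(ℝ, F) e (fun _ => w) q

/-- The Christoffel symbols at `p` in the coordinates `e`: the coordinate expression of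
`∇_{∂_v} ∂_w`, so that its components are `Γ_A{}^C{}_B v^A w^B`. -/
noncomputable def christoffel [IsManifold (𝓡 k) ∞ N] (Γ : TorsionFreeConnection k N)
   (e : N → F) (p : N) (v w : F) : F :=
  mfderiv (𝓡 k) 𝓘(ℝ, F) e p (Γ.cov (coordField e w) p (coordField e v p))

variable [IsManifold (𝓡 k) ∞ N]

theorem two_le_infty : (2 : WithTop ℕ∞) ≤ ∞ := ENat.LEInfty.out

theorem mdiff_const (w : F) (x : F) : MDifferentiableAt 𝓘(ℝ, F) (𝓘(ℝ, F).prod 𝓘(ℝ, F))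
   (fun y : F => (⟨y, w⟩ : Bundle.TotalSpace F (TangentSpace 𝓘(ℝ, F)))) x := by
  exact ((contMDiffAt_vectorSpace_iff_contDiffAt (𝕜 := ℝ) (n := 1)
    (V := fun _ : F => (w : F))).2 contDiffAt_const).mdifferentiableAt one_ne_zero

theorem mdiff_coordField {e : N → F} {p : N} (he : ContMDiffAt (𝓡 k) 𝓘(ℝ, F) ∞ e p)
    (hi : (mfderiv (𝓡 k) 𝓘(ℝ, F) e p).IsInvertible) (w : F) :
    MDifferentiableAt (𝓡 k) ((𝓡 k).prod (𝓡 k))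
      (fun q => (⟨q, coordField e w q⟩ : Bundle.TotalSpace (Eu k) (TangentSpace (𝓡 k)))) p := by
  have : IsManifold (𝓡 k) 2 N := inferInstance
  have := MDifferentiableAt.mpullback_vectorField (I := 𝓡 k) (I' := 𝓘(ℝ, F)) (f := e)
    (V := fun _ => w) (mdiff_const w (e p)) (he.of_le (m := 2) two_le_infty) hi le_rfl
  exact this

theorem christoffel_add_right (Γ : TorsionFreeConnection k N) {e : N → F} {p : N}
    (he : ContMDiffAt (𝓡 k) 𝓘(ℝ, F) ∞ e p)
    (hi : (mfderiv (𝓡 k) 𝓘(ℝ, F) e p).IsInvertible) (v w w' : F) :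
    christoffel Γ e p v (w + w') = christoffel Γ e p v w + christoffel Γ e p v w' := by
  have h1 : (coordField e (w + w') : Π q : N, TangentSpace (𝓡 k) q) = coordField e w + coordField e w' := by
    ext1 q
    exact ContinuousLinearMap.map_add
      (ContinuousLinearMap.inverse (mfderiv (𝓡 k) 𝓘(ℝ, F) e q) : F →L[ℝ] Eu k) w w'
  unfold christoffel
  rw [h1, Γ.cov.isCovariantDerivativeOnUniv.add (mdiff_coordField he hi w)
    (mdiff_coordField he hi w')]
  exact map_add _ _ _

theorem christoffel_smul_right (Γ : TorsionFreeConnection k N) {e : N → F} {p : N}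
    (he : ContMDiffAt (𝓡 k) 𝓘(ℝ, F) ∞ e p)
    (hi : (mfderiv (𝓡 k) 𝓘(ℝ, F) e p).IsInvertible) (c : ℝ) (v w : F) :
    christoffel Γ e p v (c • w) = c • christoffel Γ e p v w := by
  have h1 : (coordField e (c • w) : Π q : N, TangentSpace (𝓡 k) q) = c • coordField e w := by
    ext1 q
    exact map_smul
      (ContinuousLinearMap.inverse (mfderiv (𝓡 k) 𝓘(ℝ, F) e q) : F →L[ℝ] Eu k) c w
  unfold christoffel
  rw [h1, Γ.cov.isCovariantDerivativeOnUniv.smul_const _ (mdiff_coordField he hi w)]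
  exact map_smul (mfderiv (𝓡 k) 𝓘(ℝ, F) e p : Eu k →L[ℝ] F) c _

theorem christoffel_symm (Γ : TorsionFreeConnection k N) {e : N → F} {p : N}
    (he : ContMDiffAt (𝓡 k) 𝓘(ℝ, F) ∞ e p)
    (hi : (mfderiv (𝓡 k) 𝓘(ℝ, F) e p).IsInvertible) (v w : F) :
    christoffel Γ e p v w = christoffel Γ e p w v := by
  have h := (Γ.cov.torsion_eq_zero_iff.1 Γ.torsion_eq_zero)
    (mdiff_coordField he hi v) (mdiff_coordField he hi w)
  have hb : VectorField.mlieBracket (𝓡 k) (coordField e v) (coordField e w) p = 0 := by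
    have : IsManifold (𝓡 k) (minSmoothness ℝ 3) N := by
      simp only [minSmoothness_of_isRCLikeNormedField]; infer_instance
    have h2 := VectorField.mpullback_mlieBracket (I := 𝓡 k) (I' := 𝓘(ℝ, F)) (f := e) (n := ∞)
      (V := fun _ => v) (W := fun _ => w)
      (mdiff_const v (e p)) (mdiff_const w (e p)) he (by simpa using two_le_infty)
    refine h2.symm.trans ?_
    have h3 : VectorField.mlieBracket 𝓘(ℝ, F) (fun _ : F => v) (fun _ => w) = fun _ => 0 := by
      ext x
      exact (congrFun (VectorField.mlieBracketWithin_eq_lieBracketWithin (𝕜 := ℝ)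
        (V := fun _ : F => v) (W := fun _ => w) (s := univ)) x).trans
        (by simp [VectorField.lieBracketWithin]; rfl)
    unfold VectorField.mpullback
    rw [h3]
    exact ContinuousLinearMap.map_zero _
  rw [hb, sub_eq_zero] at h
  unfold christoffel
  rw [h]


theorem christoffel_add_left (Γ : TorsionFreeConnection k N) {e : N → F} {p : N}
    (he : ContMDiffAt (𝓡 k) 𝓘(ℝ, F) ∞ e p)
    (hi : (mfderiv (𝓡 k) 𝓘(ℝ, F) e p).IsInvertible) (v v' w : F) :
    christoffel Γ e p (v + v') w = christoffel Γ e p v w + christoffel Γ e p v' w := by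
  simp only [christoffel_symm Γ he hi _ w, christoffel_add_right Γ he hi]

theorem christoffel_smul_left (Γ : TorsionFreeConnection k N) {e : N → F} {p : N}
    (he : ContMDiffAt (𝓡 k) 𝓘(ℝ, F) ∞ e p)
    (hi : (mfderiv (𝓡 k) 𝓘(ℝ, F) e p).IsInvertible) (c : ℝ) (v w : F) :
    christoffel Γ e p (c • v) w = c • christoffel Γ e p v w := by
  simp only [christoffel_symm Γ he hi _ w, christoffel_smul_right Γ he hi]

end Connection

section Polynomial

variable {V W : Type*} [NormedAddCommGroup V] [NormedSpace ℝ V]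
  [NormedAddCommGroup W] [NormedSpace ℝ W]

theorem exists_bilin [FiniteDimensional ℝ V] (B : V → V → W) (h1 : ∀ a a' b, B (a + a') b = B a b + B a' b)
    (h2 : ∀ (c : ℝ) a b, B (c • a) b = c • B a b) (h3 : ∀ a b b', B a (b + b') = B a b + B a b')
    (h4 : ∀ (c : ℝ) a b, B a (c • b) = c • B a b) :
    ∃ Q : V →L[ℝ] V →L[ℝ] W, ∀ a b, Q a b = B a b :=
  ⟨LinearMap.toContinuousLinearMap ((LinearMap.toContinuousLinearMap :
    (V →ₗ[ℝ] W) ≃ₗ[ℝ] (V →L[ℝ] W)).toLinearMap ∘ₗ LinearMap.mk₂ ℝ B h1 h2 h3 h4),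
    fun a b => by simp⟩

theorem exists_quadratic (y₀ : V) (z₀ : W) (A : V →L[ℝ] W) (Q : V →L[ℝ] V →L[ℝ] W)
    (hQ : ∀ a b, Q a b = Q b a) :
    ∃ f : V → W, ContDiff ℝ ∞ f ∧ f y₀ = z₀ ∧ fderiv ℝ f y₀ = A ∧
      fderiv ℝ (fderiv ℝ f) y₀ = Q := by
  have hd : ∀ y, HasFDerivAt (fun y => z₀ + A (y - y₀) + (1 / 2 : ℝ) • Q (y - y₀) (y - y₀))
      (A + Q (y - y₀)) y := by
    intro y
    have h0 : HasFDerivAt (fun y : V => y - y₀) (ContinuousLinearMap.id ℝ V) y :=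
      (hasFDerivAt_id y).sub_const y₀
    have h1 := (A.hasFDerivAt.comp y h0).const_add z₀
    have h2 := ((Q.hasFDerivAt.comp y h0).clm_apply h0).const_smul (1 / 2 : ℝ)
    refine (h1.add h2).congr_fderiv ?_
    ext b
    simp
    rw [hQ b y, hQ b y₀, ← two_smul ℝ, smul_smul]; norm_num
  refine ⟨_, ?_, ?_, (hd y₀).fderiv.trans (by simp), ?_⟩
  · fun_prop
  · simp
  · rw [show fderiv ℝ (fun y => z₀ + A (y - y₀) + (1 / 2 : ℝ) • Q (y - y₀) (y - y₀)) =
      fun y => A + Q (y - y₀) from funext fun y => (hd y).fderiv]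
    have h0 : HasFDerivAt (fun y : V => y - y₀) (ContinuousLinearMap.id ℝ V) y₀ :=
      (hasFDerivAt_id y₀).sub_const y₀
    refine ((Q.hasFDerivAt.comp y₀ h0).const_add A).fderiv.trans ?_
    ext; simp

theorem iteratedFDeriv_eq_of_le_one {f g : V → W} {y : V} (h0 : f y = g y)
    (h1 : fderiv ℝ f y = fderiv ℝ g y) (k : ℕ) (hk : k ≤ 1) :
    iteratedFDeriv ℝ k f y = iteratedFDeriv ℝ k g y := by
  interval_cases k
  · ext v; simp [h0]
  · ext v; simp [iteratedFDeriv_one_apply, h1]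

end Polynomial

section SubmanifoldJets

variable (n m : ℕ) (E : Type*) [TopologicalSpace E] [ChartedSpace (Eu (n + m)) E]

/-- A divided chart `(u^λ, u^i)` on the `(n+m)`-manifold `E`: a chart of the smooth structure whose
coordinate space is split as `ℝⁿ × ℝᵐ`. -/
structure DividedChart where
  chart : OpenPartialHomeomorph E (Eu (n + m))
  chart_mem : chart ∈ IsManifold.maximalAtlas (𝓡 (n + m)) ∞ E
  split : Eu (n + m) ≃L[ℝ] Eu n × Eu m

variable {n m E}

/-- The coordinates `((u^λ), (u^i))` of a divided chart (meaningful on `u.chart.source`). -/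
def DividedChart.coord (u : DividedChart n m E) (q : E) : Eu n × Eu m := u.split (u.chart q)

theorem DividedChart.contMDiffAt [IsManifold (𝓡 (n + m)) ∞ E] (u : DividedChart n m E) {p : E}
    (hp : p ∈ u.chart.source) :
    ContMDiffAt (𝓡 (n + m)) 𝓘(ℝ, Eu n × Eu m) ∞ u.coord p :=
  u.split.contDiff.contMDiff.contMDiffAt.comp p (contMDiffAt_of_mem_maximalAtlas u.chart_mem hp)

theorem chart_mfderiv_isInvertible {k : ℕ} {N : Type*} [TopologicalSpace N]
    [ChartedSpace (Eu k) N] {e : OpenPartialHomeomorph N (Eu k)}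
    (he : e ∈ IsManifold.maximalAtlas (𝓡 k) ∞ N) {p : N} (hp : p ∈ e.source) :
    (mfderiv (𝓡 k) 𝓘(ℝ, Eu k) e p).IsInvertible := by
  have h : e.MDifferentiable (𝓡 k) (𝓡 k) :=
    ⟨(contMDiffOn_of_mem_maximalAtlas he).mdifferentiableOn (by simp),
      (contMDiffOn_symm_of_mem_maximalAtlas he).mdifferentiableOn (by simp)⟩
  exact ⟨h.mfderiv hp, rfl⟩

theorem DividedChart.isInvertible [IsManifold (𝓡 (n + m)) ∞ E] (u : DividedChart n m E) {p : E}
    (hp : p ∈ u.chart.source) :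
    (mfderiv (𝓡 (n + m)) 𝓘(ℝ, Eu n × Eu m) u.coord p).IsInvertible := by
  have h := chart_mfderiv_isInvertible u.chart_mem hp
  have h2 : mfderiv (𝓡 (n + m)) 𝓘(ℝ, Eu n × Eu m) u.coord p =
      (u.split : Eu (n + m) →L[ℝ] Eu n × Eu m) ∘L mfderiv (𝓡 (n + m)) 𝓘(ℝ, Eu (n + m)) u.chart p := by
    have h3 := mfderiv_comp p (I := 𝓡 (n + m)) (I' := 𝓘(ℝ, Eu (n + m)))
      (I'' := 𝓘(ℝ, Eu n × Eu m)) (g := u.split) (f := u.chart)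
      u.split.differentiableAt.mdifferentiableAt
      ((contMDiffAt_of_mem_maximalAtlas u.chart_mem hp).mdifferentiableAt (by simp))
    refine h3.trans ?_
    rw [mfderiv_eq_fderiv, u.split.fderiv]
    rfl
  rw [h2]
  exact (ContinuousLinearMap.isInvertible_equiv (f := u.split)).comp h

/-- The divided chart `u` is concordant to `L` at `p`: near `p` the set `L` is described by
`u^i = f^i(u^1, …, u^n)` with `f` smooth near the point in question. -/
def DividedChart.IsGraphAt (u : DividedChart n m E) (L : Set E) (p : E) (f : Eu n → Eu m) : Prop :=
  p ∈ u.chart.source ∧ (∀ᶠ x in 𝓝 (u.coord p).1, ContDiffAt ℝ ∞ f x) ∧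
    ∀ᶠ q in 𝓝 p, (q ∈ L ↔ (u.coord q).2 = f (u.coord q).1)

variable (n m E) in
/-- An `n`-dimensional embedded smooth submanifold of `E`: near each of its points it is the graph of
a smooth map in a divided chart. -/
structure Submanifold where
  carrier : Set E
  exists_isGraphAt : ∀ p ∈ carrier, ∃ (u : DividedChart n m E) (f : Eu n → Eu m),
    u.IsGraphAt carrier p f

variable (n m E) in
/-- An `n`-dimensional embedded submanifold together with one of its points. -/
structure PointedSubmanifold where
  sub : Submanifold n m E
  pt : E
  pt_mem : pt ∈ sub.carrier

/-- `L` and `L'` have a contact of order `r` at `p`: in a divided chart concordant to both, the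
functions `f`, `f'` describing them have the same derivatives at `p` up to order `r`. By the
invariance of contact under coordinate changes this is an equivalence relation and it does not
matter which such chart is used. -/
def HasContact (r : ℕ) (P P' : PointedSubmanifold n m E) : Prop :=
  P.pt = P'.pt ∧ ∃ (u : DividedChart n m E) (f f' : Eu n → Eu m),
    u.IsGraphAt P.sub.carrier P.pt f ∧ u.IsGraphAt P'.sub.carrier P.pt f' ∧
    ∀ k ≤ r, iteratedFDeriv ℝ k f (u.coord P.pt).1 = iteratedFDeriv ℝ k f' (u.coord P.pt).1

variable (n m E) in
/-- The space `J^r(E,n)` of `r`-jets `[L]^r_p` of `n`-dimensional submanifolds of `E`. -/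
def SubJet (r : ℕ) : Type _ := Quot (HasContact (n := n) (m := m) (E := E) r)

/-- The jet `[L]^r_p`. -/
def SubJet.mk (r : ℕ) (P : PointedSubmanifold n m E) : SubJet n m E r := Quot.mk _ P

/-- The projection `π_{k,h} : J^k(E,n) → J^h(E,n)`. -/
def SubJet.proj {h k : ℕ} (hk : h ≤ k) : SubJet n m E k → SubJet n m E h :=
  Quot.map id fun _ _ ⟨hp, u, f, f', hf, hf', hd⟩ =>
    ⟨hp, u, f, f', hf, hf', fun j hj => hd j (hj.trans hk)⟩

/-- The inclusion `D¹` of the tautological (pseudo-horizontal) bundle at the `1`-jet with derivative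
coordinates `P = (u^i_λ)`: it sends `∂_λ` to `∂_λ + u^i_λ ∂_i`. Its range is the tangent plane. -/
def horLift (P : Eu n →L[ℝ] Eu m) (a : Eu n) : Eu n × Eu m := (a, P a)

/-- The projection `ω` of a tangent space of `E` onto its quotient by the tangent plane with
derivative coordinates `P`, the quotient being identified with `ℝᵐ` through the basis `[∂_i]`. -/
def vertProj (P : Eu n →L[ℝ] Eu m) (y : Eu n × Eu m) : Eu m := y.2 - P y.1

/-- The connection `Γ̇` on `J¹(E,n) → E`, through its vertical form. At the `1`-jet over `p` with
derivative coordinates `P` in the divided chart `u`, it sends the tangent vector of `J¹(E,n)` with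
components `(v, P')` to the homomorphism `a ↦ ω (∇_{(v, P')} (D¹ a))` from the tangent plane to its
quotient: the covariant derivative of `D¹` along that tangent vector, projected by `ω`.
In components, `(P')^k_ξ + Γ̇_A{}^k{}_ξ v^A` with
`Γ̇_A{}^k{}_ξ = Γ_A{}^k{}_ξ + Γ_A{}^k{}_i u^i_ξ - u^k_β (Γ_A{}^β{}_ξ + Γ_A{}^β{}_i u^i_ξ)`. -/
noncomputable def dotVertical [IsManifold (𝓡 (n + m)) ∞ E] (Γ : TorsionFreeConnection (n + m) E)
    (u : DividedChart n m E) (p : E) (P : Eu n →L[ℝ] Eu m)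
    (v : Eu n × Eu m) (P' : Eu n →L[ℝ] Eu m) (a : Eu n) : Eu m :=
  vertProj P ((0, P' a) + christoffel Γ u.coord p v (horLift P a))

/-- The `R`-plane of the `2`-jet `θ = [L]²_p`, i.e. the tangent plane at `[L]¹_p` of the prolonged
submanifold `L⁽¹⁾ ⊆ J¹(E,n)`, is horizontal for `Γ̇`. In a concordant divided chart this plane
consists of the vectors with components `(D¹ b, D²f(b))`. In other words `D²(θ)` is the contraction
of `D¹` with `Γ̇`. The condition does not depend on the representative or on the chart. -/
def IsDotHorizontal [IsManifold (𝓡 (n + m)) ∞ E] (Γ : TorsionFreeConnection (n + m) E)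
    (θ : SubJet n m E 2) : Prop :=
  ∃ (L : PointedSubmanifold n m E) (u : DividedChart n m E) (f : Eu n → Eu m),
    SubJet.mk 2 L = θ ∧ u.IsGraphAt L.sub.carrier L.pt f ∧
    ∀ b a : Eu n, dotVertical Γ u L.pt (fderiv ℝ f (u.coord L.pt).1)
      (horLift (fderiv ℝ f (u.coord L.pt).1) b)
      (fderiv ℝ (fderiv ℝ f) (u.coord L.pt).1 b) a = 0

/-- Existence of the jet defining `Γ̈(θ)`. -/
theorem exists_ddotGamma [IsManifold (𝓡 (n + m)) ∞ E] (Γ : TorsionFreeConnection (n + m) E)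
    (θ : SubJet n m E 1) :
    ∃ θ₂ : SubJet n m E 2, SubJet.proj one_le_two θ₂ = θ ∧ IsDotHorizontal Γ θ₂ := by
  induction θ using Quot.ind with | mk L =>
  obtain ⟨u, f, hu⟩ := L.sub.exists_isGraphAt L.pt L.pt_mem
  set x₀ := (u.coord L.pt).1 with hx₀
  set P := fderiv ℝ f x₀ with hP
  have he := u.contMDiffAt hu.1
  have hi := u.isInvertible hu.1
  have hl : ∀ a a', horLift P (a + a') = horLift P a + horLift P a' := by
    intro a a'; simp [horLift]
  have hs : ∀ (c : ℝ) a, horLift P (c • a) = c • horLift P a := by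
    intro a a'; simp [horLift]
  have hl' : ∀ a a', vertProj P (a + a') = vertProj P a + vertProj P a' := by
    intro a a'; simp [vertProj]; abel
  have hs' : ∀ (c : ℝ) a, vertProj P (c • a) = c • vertProj P a := by
    intro a a'; simp [vertProj, smul_sub]
  obtain ⟨Q, hQ⟩ := exists_bilin
    (fun b a : Eu n => -vertProj P (christoffel Γ u.coord L.pt (horLift P b) (horLift P a)))
    (fun b b' a => by rw [hl, christoffel_add_left Γ he hi, hl', neg_add])
    (fun c b a => by rw [hs, christoffel_smul_left Γ he hi, hs', smul_neg])
    (fun b a a' => by rw [hl, christoffel_add_right Γ he hi, hl', neg_add])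
    (fun c b a => by rw [hs, christoffel_smul_right Γ he hi, hs', smul_neg])
  obtain ⟨g, hg, hg0, hg1, hg2⟩ := exists_quadratic x₀ (f x₀) P Q
    (fun a b => by rw [hQ, hQ, christoffel_symm Γ he hi])
  have hpL : (u.coord L.pt).2 = f x₀ := (hu.2.2.self_of_nhds).1 L.pt_mem
  have hG : ∀ p ∈ u.chart.source,
      u.IsGraphAt {q | q ∈ u.chart.source ∧ (u.coord q).2 = g (u.coord q).1} p g := by
    intro p hp
    refine ⟨hp, Eventually.of_forall fun _ => hg.contDiffAt, ?_⟩
    filter_upwards [u.chart.open_source.mem_nhds hp] with q hq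
    exact ⟨fun h => h.2, fun h => ⟨hq, h⟩⟩
  let L' : PointedSubmanifold n m E :=
    { sub := ⟨{q | q ∈ u.chart.source ∧ (u.coord q).2 = g (u.coord q).1},
        fun p hp => ⟨u, g, hG p hp.1⟩⟩
      pt := L.pt
      pt_mem := ⟨hu.1, by rw [hpL, ← hx₀, hg0]⟩ }
  refine ⟨SubJet.mk 2 L', Quot.sound ⟨rfl, u, g, f, hG L.pt hu.1, hu, ?_⟩, L', u, g, rfl,
    hG L.pt hu.1, ?_⟩
  · exact iteratedFDeriv_eq_of_le_one hg0 hg1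
  · intro b a
    simp only [L', ← hx₀, hg1, hg2, dotVertical, hl', hQ]
    simp [vertProj]

/-- The section `Γ̈ : J¹(E,n) → J²(E,n)` of `π_{2,1}` associated with `Γ̇`: `Γ̈(θ)` is the (unique)
`2`-jet over `θ` whose `R`-plane is the `Γ̇`-horizontal lift of the tangent plane `θ`, that is
`D² ∘ Γ̈ = D¹ ⌟ Γ̇`. -/
noncomputable def ddotGamma [IsManifold (𝓡 (n + m)) ∞ E] (Γ : TorsionFreeConnection (n + m) E)
    (θ : SubJet n m E 1) : SubJet n m E 2 := (exists_ddotGamma Γ θ).choose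

theorem ddotGamma_spec [IsManifold (𝓡 (n + m)) ∞ E] (Γ : TorsionFreeConnection (n + m) E)
    (θ : SubJet n m E 1) :
    SubJet.proj one_le_two (ddotGamma Γ θ) = θ ∧ IsDotHorizontal Γ (ddotGamma Γ θ) :=
  (exists_ddotGamma Γ θ).choose_spec

/-- The universal second fundamental form `II(X, Y) = ω (∇_X̃ Y)` at the `2`-jet over `p` with first
and second derivative coordinates `P`, `P₂` in the divided chart `u`; `X`, `Y` stand for the
pseudo-horizontal vectors `D¹ X`, `D¹ Y`. -/
noncomputable def secondFundamentalForm [IsManifold (𝓡 (n + m)) ∞ E]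
    (Γ : TorsionFreeConnection (n + m) E) (u : DividedChart n m E) (p : E)
    (P : Eu n →L[ℝ] Eu m) (P₂ : Eu n →L[ℝ] Eu n →L[ℝ] Eu m) (X Y : Eu n) : Eu m :=
  vertProj P ((0, P₂ X Y) + christoffel Γ u.coord p (horLift P X) (horLift P Y))

/-- The equation `S ⊆ J²(E,n)` of unparametrized totally geodesic submanifolds: `II = 0`. -/
def geodesicEquation [IsManifold (𝓡 (n + m)) ∞ E] (Γ : TorsionFreeConnection (n + m) E) :
    Set (SubJet n m E 2) :=
  {θ | ∃ (L : PointedSubmanifold n m E) (u : DividedChart n m E) (f : Eu n → Eu m),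
    SubJet.mk 2 L = θ ∧ u.IsGraphAt L.sub.carrier L.pt f ∧
    ∀ X Y : Eu n, secondFundamentalForm Γ u L.pt (fderiv ℝ f (u.coord L.pt).1)
      (fderiv ℝ (fderiv ℝ f) (u.coord L.pt).1) X Y = 0}

end SubmanifoldJets

section SectionJets

variable (n m : ℕ) (M E : Type*) [TopologicalSpace M] [ChartedSpace (Eu n) M]
  [TopologicalSpace E] [ChartedSpace (Eu (n + m)) E]

/-- A local section `x ↦ (x, s(x))` of `pr_M : M × E → M`, i.e. a smooth map `s` from an open subset
of `M` to `E`, together with a point of its domain. The values of `toFun` outside `domain` are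
irrelevant. -/
structure PointedSection where
  domain : Set M
  isOpen_domain : IsOpen domain
  toFun : M → E
  contMDiffOn : ContMDiffOn (𝓡 n) (𝓡 (n + m)) ∞ toFun domain
  pt : M
  pt_mem : pt ∈ domain

variable {n m M E}

/-- The point `s(x) ∈ E`. -/
def PointedSection.val (s : PointedSection n m M E) : E := s.toFun s.pt

/-- The local section is an immersion of its domain into `E` (a parametrized submanifold). -/
def PointedSection.IsImmersion (s : PointedSection n m M E) : Prop :=
  ∀ x ∈ s.domain, IsImmersionAt (𝓡 n) (𝓡 (n + m)) ∞ s.toFun x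

/-- `ψ` and `φ` are charts of the smooth structures of `M` and `E` around `x` and `s(x)`. -/
structure PointedSection.IsChartPair (s : PointedSection n m M E)
    (ψ : OpenPartialHomeomorph M (Eu n)) (φ : OpenPartialHomeomorph E (Eu (n + m))) : Prop where
  dom_mem : ψ ∈ IsManifold.maximalAtlas (𝓡 n) ∞ M
  cod_mem : φ ∈ IsManifold.maximalAtlas (𝓡 (n + m)) ∞ E
  pt_mem : s.pt ∈ ψ.source
  val_mem : s.val ∈ φ.source

/-- The coordinate expression `u^A = s^A(x^1, …, x^n)` of `s`. -/
def PointedSection.localRep (s : PointedSection n m M E)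
    (ψ : OpenPartialHomeomorph M (Eu n)) (φ : OpenPartialHomeomorph E (Eu (n + m))) :
    Eu n → Eu (n + m) := φ ∘ s.toFun ∘ ψ.symm

/-- Two local sections have the same `r`-jet: same point `x`, same value `s(x)`, and in charts the
same derivatives at `x` up to order `r`. By the chain rule this is an equivalence relation and it
does not matter which charts are used. -/
def HasSameJet (r : ℕ) (s s' : PointedSection n m M E) : Prop :=
  s.pt = s'.pt ∧ s.val = s'.val ∧
    ∃ (ψ : OpenPartialHomeomorph M (Eu n)) (φ : OpenPartialHomeomorph E (Eu (n + m))),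
      s.IsChartPair ψ φ ∧ ∀ k ≤ r,
        iteratedFDeriv ℝ k (s.localRep ψ φ) (ψ s.pt) =
          iteratedFDeriv ℝ k (s'.localRep ψ φ) (ψ s.pt)

variable (n m M E) in
/-- The `r`-jet bundle `J^r pr_M` of `pr_M : M × E → M`. -/
def SecJet (r : ℕ) : Type _ := Quot (HasSameJet (n := n) (m := m) (M := M) (E := E) r)

/-- The jet `[s]^r_x`. -/
def SecJet.mk (r : ℕ) (s : PointedSection n m M E) : SecJet n m M E r := Quot.mk _ s

/-- The projection `J^k pr_M → J^h pr_M`. -/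
def SecJet.proj {h k : ℕ} (hk : h ≤ k) : SecJet n m M E k → SecJet n m M E h :=
  Quot.map id fun _ _ ⟨hp, hv, ψ, φ, hc, hd⟩ =>
    ⟨hp, hv, ψ, φ, hc, fun j hj => hd j (hj.trans hk)⟩

variable (n m M E) in
/-- The subset `Imm J^r pr_M ⊆ J^r pr_M` of `r`-jets of immersions. -/
def ImmJet (r : ℕ) : Set (SecJet n m M E r) :=
  {θ | ∃ s : PointedSection n m M E, s.IsImmersion ∧ SecJet.mk r s = θ}

/-- The connection `Γ̇_{pr_M} = pr_E^*(Γ) ⊗ pr_M^*(Θ^*)` on `J¹ pr_M ≅ pr_E^*(TE) ⊗ pr_M^*(T^*M)`, through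
its vertical form. At the `1`-jet over `(x, p)` with derivative coordinates `A = (u^C_{x^λ})` it sends
the tangent vector with components `(x', v, A')` to `a ↦ A' a + Γ(v, A a) - A (Θ(x', a))`. -/
noncomputable def dotVerticalSec [IsManifold (𝓡 n) ∞ M] [IsManifold (𝓡 (n + m)) ∞ E]
    (Γ : TorsionFreeConnection (n + m) E) (Θ : TorsionFreeConnection n M)
    (ψ : OpenPartialHomeomorph M (Eu n)) (φ : OpenPartialHomeomorph E (Eu (n + m)))
    (x : M) (p : E) (A : Eu n →L[ℝ] Eu (n + m))
    (x' : Eu n) (v : Eu (n + m)) (A' : Eu n →L[ℝ] Eu (n + m)) (a : Eu n) : Eu (n + m) :=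
  A' a + christoffel Γ φ p v (A a) - A (christoffel Θ ψ x x' a)

/-- The `R`-plane of the `2`-jet `θ = [s]²_x`, i.e. the tangent plane at `[s]¹_x` of the image of the
first prolongation of `s`, is horizontal for `Γ̇_{pr_M}`. In charts this plane consists of the vectors
with components `(b, Ds(b), D²s(b))`. The condition does not depend on the representative or on the
charts. -/
def IsDotHorizontalSec [IsManifold (𝓡 n) ∞ M] [IsManifold (𝓡 (n + m)) ∞ E]
    (Γ : TorsionFreeConnection (n + m) E) (Θ : TorsionFreeConnection n M)
    (θ : SecJet n m M E 2) : Prop :=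
  ∃ (s : PointedSection n m M E)
    (ψ : OpenPartialHomeomorph M (Eu n)) (φ : OpenPartialHomeomorph E (Eu (n + m))),
    SecJet.mk 2 s = θ ∧ s.IsChartPair ψ φ ∧
    ∀ b a : Eu n, dotVerticalSec Γ Θ ψ φ s.pt s.val (fderiv ℝ (s.localRep ψ φ) (ψ s.pt))
      b (fderiv ℝ (s.localRep ψ φ) (ψ s.pt) b)
      (fderiv ℝ (fderiv ℝ (s.localRep ψ φ)) (ψ s.pt) b) a = 0

/-- Existence of the jet defining `Γ̈_{pr_M}(θ)`. -/
theorem exists_ddotGammaSec [IsManifold (𝓡 n) ∞ M] [IsManifold (𝓡 (n + m)) ∞ E]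
    (Γ : TorsionFreeConnection (n + m) E) (Θ : TorsionFreeConnection n M)
    (θ : SecJet n m M E 1) :
    ∃ θ₂ : SecJet n m M E 2, SecJet.proj one_le_two θ₂ = θ ∧ IsDotHorizontalSec Γ Θ θ₂ := by
  induction θ using Quot.ind with | mk s =>
  set ψ := chartAt (Eu n) s.pt
  set φ := chartAt (Eu (n + m)) s.val
  have hψ : ψ ∈ IsManifold.maximalAtlas (𝓡 n) ∞ M := IsManifold.chart_mem_maximalAtlas _
  have hφ : φ ∈ IsManifold.maximalAtlas (𝓡 (n + m)) ∞ E := IsManifold.chart_mem_maximalAtlas _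
  have hx : s.pt ∈ ψ.source := mem_chart_source _ _
  have hp : s.val ∈ φ.source := mem_chart_source _ _
  set A := fderiv ℝ (s.localRep ψ φ) (ψ s.pt)
  have he := contMDiffAt_of_mem_maximalAtlas hφ hp
  have hi := chart_mfderiv_isInvertible hφ hp
  have he' := contMDiffAt_of_mem_maximalAtlas hψ hx
  have hi' := chart_mfderiv_isInvertible hψ hx
  obtain ⟨Q, hQ⟩ := exists_bilin
    (fun b a : Eu n => A (christoffel Θ ψ s.pt b a) - christoffel Γ φ s.val (A b) (A a))
    (fun b b' a => by
      rw [map_add, christoffel_add_left Γ he hi, christoffel_add_left Θ he' hi', map_add]; abel)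
    (fun c b a => by
      rw [map_smul, christoffel_smul_left Γ he hi, christoffel_smul_left Θ he' hi', map_smul,
        smul_sub])
    (fun b a a' => by
      rw [map_add, christoffel_add_right Γ he hi, christoffel_add_right Θ he' hi', map_add]; abel)
    (fun c b a => by
      rw [map_smul, christoffel_smul_right Γ he hi, christoffel_smul_right Θ he' hi', map_smul,
        smul_sub])
  obtain ⟨g, hg, hg0, hg1, hg2⟩ := exists_quadratic (ψ s.pt) (φ s.val) A Q
    (fun a b => by rw [hQ, hQ, christoffel_symm Γ he hi, christoffel_symm Θ he' hi'])
  let s' : PointedSection n m M E :=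
    { domain := ψ.source ∩ ψ ⁻¹' (g ⁻¹' φ.target)
      isOpen_domain := ψ.isOpen_inter_preimage (φ.open_target.preimage hg.continuous)
      toFun := φ.symm ∘ g ∘ ψ
      contMDiffOn := by
        refine (contMDiffOn_symm_of_mem_maximalAtlas hφ).comp
          (hg.contMDiff.comp_contMDiffOn ((contMDiffOn_of_mem_maximalAtlas hψ).mono
            inter_subset_left)) ?_
        intro y hy
        exact hy.2
      pt := s.pt
      pt_mem := ⟨hx, by simpa [hg0] using φ.map_source hp⟩ }
  have hval : s'.val = s.val := by
    simp [s', PointedSection.val, hg0]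
    exact φ.left_inv hp
  have hc : s.IsChartPair ψ φ := ⟨hψ, hφ, hx, hp⟩
  have hc' : s'.IsChartPair ψ φ := ⟨hψ, hφ, hx, by rw [hval]; exact hp⟩
  have hloc : s'.localRep ψ φ =ᶠ[𝓝 (ψ s.pt)] g := by
    have h1 : g ⁻¹' φ.target ∈ 𝓝 (ψ s.pt) :=
      (φ.open_target.preimage hg.continuous).mem_nhds (by simpa [hg0] using φ.map_source hp)
    filter_upwards [h1, ψ.open_target.mem_nhds (ψ.map_source hx)] with y hy hy'
    simp only [PointedSection.localRep, s', Function.comp, ψ.right_inv hy']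
    exact φ.right_inv hy
  have hd1 : fderiv ℝ (s'.localRep ψ φ) (ψ s.pt) = A := hloc.fderiv_eq.trans hg1
  have hd2 : fderiv ℝ (fderiv ℝ (s'.localRep ψ φ)) (ψ s.pt) = Q :=
    hloc.fderiv.fderiv_eq.trans hg2
  refine ⟨SecJet.mk 2 s', Quot.sound ⟨rfl, hval, ψ, φ, hc', ?_⟩, s', ψ, φ, rfl, hc', ?_⟩
  · refine iteratedFDeriv_eq_of_le_one ?_ hd1
    refine hloc.self_of_nhds.trans (hg0.trans ?_)
    simp only [PointedSection.localRep, Function.comp, PointedSection.val]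
    exact congrArg (fun y => φ (s.toFun y)) (ψ.left_inv hx).symm
  · intro b a
    have e1 : s'.pt = s.pt := rfl
    rw [e1, hd1, hd2, hval]
    simp [dotVerticalSec, hQ]

/-- The section `Γ̈_{pr_M} : J¹ pr_M → J² pr_M` associated with `Γ̇_{pr_M}`: `Γ̈_{pr_M}(θ)` is the (unique)
`2`-jet over `θ` whose `R`-plane is horizontal for `Γ̇_{pr_M}`. -/
noncomputable def ddotGammaSec [IsManifold (𝓡 n) ∞ M] [IsManifold (𝓡 (n + m)) ∞ E]
    (Γ : TorsionFreeConnection (n + m) E) (Θ : TorsionFreeConnection n M)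
    (θ : SecJet n m M E 1) : SecJet n m M E 2 := (exists_ddotGammaSec Γ Θ θ).choose

theorem ddotGammaSec_spec [IsManifold (𝓡 n) ∞ M] [IsManifold (𝓡 (n + m)) ∞ E]
    (Γ : TorsionFreeConnection (n + m) E) (Θ : TorsionFreeConnection n M)
    (θ : SecJet n m M E 1) :
    SecJet.proj one_le_two (ddotGammaSec Γ Θ θ) = θ ∧
      IsDotHorizontalSec Γ Θ (ddotGammaSec Γ Θ θ) :=
  (exists_ddotGammaSec Γ Θ θ).choose_spec

/-- The form `II_{pr_M}(X, Y)` at the `2`-jet over `(x, p)` with first and second derivative coordinates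
`A`, `A₂`: in components `u^C_{x^ξ x^λ} + Γ_A{}^C{}_B u^A_{x^ξ} u^B_{x^λ} - Θ_ξ{}^η{}_λ u^C_{x^η}`. -/
noncomputable def secondFundamentalFormSec [IsManifold (𝓡 n) ∞ M] [IsManifold (𝓡 (n + m)) ∞ E]
    (Γ : TorsionFreeConnection (n + m) E) (Θ : TorsionFreeConnection n M)
    (ψ : OpenPartialHomeomorph M (Eu n)) (φ : OpenPartialHomeomorph E (Eu (n + m)))
    (x : M) (p : E) (A : Eu n →L[ℝ] Eu (n + m)) (A₂ : Eu n →L[ℝ] Eu n →L[ℝ] Eu (n + m))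
    (X Y : Eu n) : Eu (n + m) :=
  A₂ X Y + christoffel Γ φ p (A X) (A Y) - A (christoffel Θ ψ x X Y)

/-- The equation `S_{pr_M} ⊆ Imm J² pr_M` of parametrized totally geodesic submanifolds:
`II_{pr_M} = 0`. -/
def geodesicEquationSec [IsManifold (𝓡 n) ∞ M] [IsManifold (𝓡 (n + m)) ∞ E]
    (Γ : TorsionFreeConnection (n + m) E) (Θ : TorsionFreeConnection n M) :
    Set (ImmJet n m M E 2) :=
  {θ | ∃ (s : PointedSection n m M E)
    (ψ : OpenPartialHomeomorph M (Eu n)) (φ : OpenPartialHomeomorph E (Eu (n + m))),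
    SecJet.mk 2 s = θ.1 ∧ s.IsChartPair ψ φ ∧
    ∀ X Y : Eu n, secondFundamentalFormSec Γ Θ ψ φ s.pt s.val
      (fderiv ℝ (s.localRep ψ φ) (ψ s.pt))
      (fderiv ℝ (fderiv ℝ (s.localRep ψ φ)) (ψ s.pt)) X Y = 0}

/-- An immersion maps a small neighbourhood of the given point onto an embedded submanifold. -/
theorem PointedSection.exists_image (s : PointedSection n m M E) (hs : s.IsImmersion) :
    ∃ (U : Set M) (L : PointedSubmanifold n m E), IsOpen U ∧ s.pt ∈ U ∧ U ⊆ s.domain ∧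
      L.sub.carrier = s.toFun '' U ∧ L.pt = s.val := by
  have h := hs s.pt s.pt_mem
  set ψ := h.domChart
  set φ := h.codChart
  have hψ := h.mem_domChart_source
  have hw : ∀ x ∈ ψ.source, φ (s.toFun x) = h.equiv (ψ x, 0) := by
    intro x hx
    have hmem : ψ x ∈ (h.domChart.extend (𝓡 n)).target := by
      rw [OpenPartialHomeomorph.extend_target]
      simpa using ψ.map_source hx
    have := h.writtenInCharts hmem
    simp only [Function.comp, OpenPartialHomeomorph.extend_coe,
      OpenPartialHomeomorph.extend_coe_symm] at this
    have hinv : h.domChart.symm (ψ x) = x := ψ.left_inv hx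
    simp [hinv] at this
    exact this
  have hsub : ∀ x ∈ ψ.source, s.toFun x ∈ φ.source := fun x hx => h.source_subset_preimage_source hx
  have : FiniteDimensional ℝ (Eu n × h.complement) := h.equiv.symm.toLinearEquiv.finiteDimensional
  have : FiniteDimensional ℝ h.complement :=
    FiniteDimensional.of_surjective (LinearMap.snd ℝ (Eu n) h.complement)
      LinearMap.snd_surjective
  have hfr : Module.finrank ℝ h.complement = Module.finrank ℝ (Eu m) := by
    have := h.equiv.toLinearEquiv.finrank_eq
    simp [Module.finrank_prod] at this ⊢
    exact this
  let g : h.complement ≃L[ℝ] Eu m := ContinuousLinearEquiv.ofFinrankEq hfr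
  let u : DividedChart n m E :=
    { chart := φ
      chart_mem := h.codChart_mem_maximalAtlas
      split := h.equiv.symm.trans ((ContinuousLinearEquiv.refl ℝ (Eu n)).prodCongr g) }
  have hu : ∀ x ∈ ψ.source, u.coord (s.toFun x) = (ψ x, 0) := by
    intro x hx
    simp [DividedChart.coord, u, hw x hx]
  have hinj : ∀ q ∈ φ.source, ∀ q' ∈ φ.source, u.coord q = u.coord q' → q = q' := by
    intro q hq q' hq' hqq
    exact φ.injOn hq hq' (u.split.injective hqq)
  set U := ψ.source ∩ s.domain with hU
  have hUo : IsOpen U := ψ.open_source.inter s.isOpen_domain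
  have key : ∀ p ∈ s.toFun '' U, u.IsGraphAt (s.toFun '' U) p (fun _ => 0) := by
    rintro p ⟨x, hx, rfl⟩
    refine ⟨hsub x hx.1, Eventually.of_forall fun _ => contDiffAt_const, ?_⟩
    have hopen : IsOpen (ψ '' U) := ψ.isOpen_image_of_subset_source hUo inter_subset_left
    have hcont : ContinuousAt (fun q => (u.coord q).1) (s.toFun x) :=
      (continuous_fst.comp u.split.continuous).continuousAt.comp
        (φ.continuousAt (hsub x hx.1))
    have hn : (fun q => (u.coord q).1) ⁻¹' (ψ '' U) ∈ 𝓝 (s.toFun x) :=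
      hcont (hopen.mem_nhds ⟨x, hx, by simp [hu x hx.1]⟩)
    filter_upwards [hn, φ.open_source.mem_nhds (hsub x hx.1)] with q hq hqs
    constructor
    · rintro ⟨y, hy, rfl⟩
      simp [hu y hy.1]
    · intro h0
      obtain ⟨y, hy, hyq⟩ := hq
      refine ⟨y, hy, hinj _ (hsub y hy.1) _ hqs ?_⟩
      rw [hu y hy.1, hyq, ← h0]
  exact ⟨U, ⟨⟨s.toFun '' U, fun p hp => ⟨u, _, key p hp⟩⟩, s.val, s.pt, ⟨hψ, s.pt_mem⟩, rfl⟩, hUo,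
    ⟨hψ, s.pt_mem⟩, inter_subset_right, rfl, rfl⟩

/-- `θ' = [s(U)]^r_{s(x)}` for some immersion `s` with `[s]^r_x = θ` and some open neighbourhood `U` of
`x` on which the image of `s` is an embedded submanifold. The jet `θ'` depends only on `θ`. -/
def IsProlongation (r : ℕ) (θ : SecJet n m M E r) (θ' : SubJet n m E r) : Prop :=
  ∃ (s : PointedSection n m M E) (U : Set M) (L : PointedSubmanifold n m E),
    s.IsImmersion ∧ SecJet.mk r s = θ ∧
    IsOpen U ∧ s.pt ∈ U ∧ U ⊆ s.domain ∧ L.sub.carrier = s.toFun '' U ∧ L.pt = s.val ∧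
    θ' = SubJet.mk r L

theorem exists_prolongation (r : ℕ) (θ : ImmJet n m M E r) :
    ∃ θ' : SubJet n m E r, IsProlongation r θ.1 θ' := by
  obtain ⟨s, hs, h⟩ := θ.2
  obtain ⟨U, L, h1, h2, h3, h4, h5⟩ := s.exists_image hs
  exact ⟨SubJet.mk r L, s, U, L, hs, h, h1, h2, h3, h4, h5, rfl⟩

/-- The `r`-prolongation `pr_E^{(r)} : Imm J^r pr_M → J^r(E,n)`, `[s]^r_x ↦ [im s]^r_{s(x)}`, where `im s`
is the image of a neighbourhood of `x` on which `s` is an embedding. -/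
noncomputable def prolong (r : ℕ) (θ : ImmJet n m M E r) : SubJet n m E r :=
  (exists_prolongation r θ).choose

end SectionJets

end JetSubmfd

/-! Fix a chart of `E`, let `c` be the coordinate expression of an immersion and write `Γ`, `Θ` for
the Christoffel symbols. Horizontality of the 2-jet of the section says `D²c(b,a) + Γ(Dc b, Dc a) =
Dc(Θ(b,a))`. Horizontality of the 2-jet of the image says only that the left side lies in the range
of `Dc`, that is, vanishes modulo the tangent plane. The first condition plainly implies the second,
so prolongation carries horizontal jets to horizontal jets (`IsProlongation.isDotHorizontal`).

The description of the second condition is `IsLocalParam.dotVertical_eq`. It rests on the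
transformation law `christoffel_transition`, whose inhomogeneous term is exactly the one in the
second-order chain rule, and on the fact that a change of parameters (`IsLocalParam.exists_reparam`)
adds only tangent vectors.

The commuting square then follows from uniqueness: over a given 1-jet there is a single horizontal
2-jet (`SubJet.eq_of_isDotHorizontal`), and both sides of the identity lie over the prolonged 1-jet
by `IsProlongation.proj_eq`. Being the jet of an immersion depends only on the first derivative
(`SecJet.mem_immJet_of_proj`). The statement on totally geodesic equations needs no more than the
preservation of horizontality.

The jet spaces are quotients by relations whose transitivity is not part of the definition. Equality
of jets is therefore exploited through invariants: base point, tangent plane and horizontality for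
submanifolds, derivatives in every pair of charts for sections. Conversely,
`PointedSubmanifold.exists_common_chart` produces a contact from equal invariants. -/

namespace JetSubmfd

/-! ### Jets of maps between normed spaces and the inverse function theorem -/

section Calculus

variable {V W X : Type*} [NormedAddCommGroup V] [NormedSpace ℝ V]
  [NormedAddCommGroup W] [NormedSpace ℝ W] [NormedAddCommGroup X] [NormedSpace ℝ X]

/-- The functions `f` and `g` have the same derivatives up to order `r` at `x`. -/
def JetEq (r : ℕ) (f g : V → W) (x : V) : Prop :=
  ∀ k ≤ r, iteratedFDeriv ℝ k f x = iteratedFDeriv ℝ k g x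

theorem JetEq.eq {r : ℕ} {f g : V → W} {x : V} (h : JetEq r f g x) : f x = g x := by
  simpa using congrArg (fun T => T 0) (h 0 (Nat.zero_le _))

theorem JetEq.fderiv_eq {r : ℕ} {f g : V → W} {x : V} (h : JetEq r f g x) (hr : 1 ≤ r) :
    fderiv ℝ f x = fderiv ℝ g x := by
  ext v
  simpa [iteratedFDeriv_one_apply] using congrArg (fun T => T fun _ => v) (h 1 hr)

theorem JetEq.fderiv_fderiv_eq {r : ℕ} {f g : V → W} {x : V} (h : JetEq r f g x) (hr : 2 ≤ r) :
    fderiv ℝ (fderiv ℝ f) x = fderiv ℝ (fderiv ℝ g) x := by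
  ext v w
  simpa [iteratedFDeriv_two_apply] using congrArg (fun T => T ![v, w]) (h 2 hr)

theorem jetEq_two {f g : V → W} {x : V} (h0 : f x = g x) (h1 : fderiv ℝ f x = fderiv ℝ g x)
    (h2 : fderiv ℝ (fderiv ℝ f) x = fderiv ℝ (fderiv ℝ g) x) : JetEq 2 f g x := by
  intro k hk
  obtain hk | rfl := Nat.lt_or_eq_of_le hk
  · exact iteratedFDeriv_eq_of_le_one h0 h1 k (Nat.lt_succ_iff.1 hk)
  · ext v
    simp [iteratedFDeriv_two_apply, h2]

theorem JetEq.congr {r : ℕ} {f f' g g' : V → W} {x : V} (h : JetEq r f g x)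
    (hf : f =ᶠ[𝓝 x] f') (hg : g =ᶠ[𝓝 x] g') : JetEq r f' g' x := fun k hk => by
  rw [← (hf.iteratedFDeriv ℝ k).eq_of_nhds, ← (hg.iteratedFDeriv ℝ k).eq_of_nhds, h k hk]

/-- In the Faà di Bruno formula of order `k` each term comes from a partition with at most `k`
parts, each of size at most `k`; no coefficient beyond order `r` enters. -/
theorem taylorComp_congr {q q' : FormalMultilinearSeries ℝ W X}
    {p p' : FormalMultilinearSeries ℝ V W} {r k : ℕ} (hk : k ≤ r)
    (hq : ∀ i ≤ r, q i = q' i) (hp : ∀ i ≤ r, p i = p' i) :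
    q.taylorComp p k = q'.taylorComp p' k := by
  refine Finset.sum_congr rfl fun c _ => ?_
  unfold FormalMultilinearSeries.compAlongOrderedFinpartition
  rw [hq _ (c.length_le.trans hk)]
  congr 1
  funext i
  exact hp _ ((c.partSize_le i).trans hk)

theorem JetEq.comp {r : ℕ} {f f' : V → W} {g g' : W → X} {x : V}
    (hg : ContDiffAt ℝ r g (f x)) (hg' : ContDiffAt ℝ r g' (f x))
    (hf : ContDiffAt ℝ r f x) (hf' : ContDiffAt ℝ r f' x)
    (hgg : JetEq r g g' (f x)) (hff : JetEq r f f' x) : JetEq r (g ∘ f) (g' ∘ f') x := by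
  intro k hk
  have hk' : ((k : ℕ) : WithTop ℕ∞) ≤ r := by exact_mod_cast hk
  rw [iteratedFDeriv_comp hg hf hk', iteratedFDeriv_comp (hff.eq ▸ hg') hf' hk']
  refine taylorComp_congr hk (fun i hi => ?_) hff
  rw [← hff.eq]
  exact hgg i hi

theorem fderiv_fderiv_comp {g : W → X} {f : V → W} {x : V} (hg : ContDiffAt ℝ 2 g (f x))
    (hf : ContDiffAt ℝ 2 f x) (a b : V) :
    fderiv ℝ (fderiv ℝ (g ∘ f)) x a b =
      fderiv ℝ (fderiv ℝ g) (f x) (fderiv ℝ f x a) (fderiv ℝ f x b) +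
        fderiv ℝ g (f x) (fderiv ℝ (fderiv ℝ f) x a b) := by
  have h1 : fderiv ℝ (g ∘ f) =ᶠ[𝓝 x] fun y => (fderiv ℝ g (f y)).comp (fderiv ℝ f y) := by
    filter_upwards [hf.eventually (by simp), hf.continuousAt.eventually (hg.eventually (by simp))]
      with y hy hy'
    exact fderiv_comp y (hy'.differentiableAt (by simp)) (hy.differentiableAt (by simp))
  have hg' : DifferentiableAt ℝ (fderiv ℝ g) (f x) :=
    (hg.fderiv_right (m := 1) (by norm_num)).differentiableAt (by simp)
  have hf' : DifferentiableAt ℝ (fderiv ℝ f) x :=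
    (hf.fderiv_right (m := 1) (by norm_num)).differentiableAt (by simp)
  have hf1 : DifferentiableAt ℝ f x := hf.differentiableAt (by simp)
  have hgf : HasFDerivAt (fun y => fderiv ℝ g (f y))
      ((fderiv ℝ (fderiv ℝ g) (f x)).comp (fderiv ℝ f x)) x :=
    hg'.hasFDerivAt.comp x hf1.hasFDerivAt
  rw [h1.fderiv_eq, (hgf.clm_comp hf'.hasFDerivAt).fderiv]
  simp [add_comm]

/-- The inverse function theorem, restricted to an open set on which `f` is smooth with invertible
derivative. This makes the inverse smooth on the whole target and not just at one point, as charts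
and graph functions require. -/
theorem exists_openPartialHomeomorph [CompleteSpace V] {f : V → W} {x : V}
    (hf : ∀ᶠ y in 𝓝 x, ContDiffAt ℝ ∞ f y) (hi : (fderiv ℝ f x).IsInvertible) :
    ∃ Φ : OpenPartialHomeomorph V W, x ∈ Φ.source ∧ ⇑Φ = f ∧
      (∀ y ∈ Φ.source, ContDiffAt ℝ ∞ f y) ∧ ∀ z ∈ Φ.target, ContDiffAt ℝ ∞ Φ.symm z := by
  obtain ⟨f', hf'⟩ := hi
  have hx := hf.self_of_nhds
  have hd : HasFDerivAt f (f' : V →L[ℝ] W) x := by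
    rw [hf']; exact (hx.differentiableAt (by simp)).hasFDerivAt
  have hinv : ∀ᶠ y in 𝓝 x, (fderiv ℝ f y) ∈ range ((↑) : (V ≃L[ℝ] W) → V →L[ℝ] W) := by
    have hc : ContinuousAt (fderiv ℝ f) x :=
      (hx.fderiv_right (m := 0) (by norm_num)).continuousAt
    exact hc (hf' ▸ f'.nhds)
  obtain ⟨s, hs, hso, hxs⟩ := eventually_nhds_iff.1 (hf.and hinv)
  let Φ := (hx.toOpenPartialHomeomorph f hd (by simp)).restrOpen s hso
  refine ⟨Φ, ⟨hx.mem_toOpenPartialHomeomorph_source hd (by simp), hxs⟩, rfl,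
    fun y hy => (hs y hy.2).1, fun z hz => ?_⟩
  obtain ⟨h1, g, hg⟩ := hs _ (Φ.map_target hz).2
  refine Φ.contDiffAt_symm (f₀' := g) hz ?_ h1
  rw [hg]
  exact (h1.differentiableAt (by simp)).hasFDerivAt

theorem isInvertible_of_injective [FiniteDimensional ℝ V] [FiniteDimensional ℝ W]
    (hd : Module.finrank ℝ V = Module.finrank ℝ W) {A : V →L[ℝ] W}
    (hA : Function.Injective A) : A.IsInvertible := by
  refine ⟨(LinearEquiv.ofInjectiveOfFinrankEq (A : V →ₗ[ℝ] W) hA hd).toContinuousLinearEquiv, ?_⟩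
  ext v
  rfl

end Calculus

/-! ### Christoffel symbols under a change of coordinates -/

section ChristoffelTransformation

variable {k : ℕ} {N : Type*} [TopologicalSpace N] [ChartedSpace (Eu k) N]

variable {F F' : Type*} [NormedAddCommGroup F] [NormedSpace ℝ F]
  [NormedAddCommGroup F'] [NormedSpace ℝ F']

theorem mfderiv_coordField {e : N → F} {p : N}
    (hi : (mfderiv (𝓡 k) 𝓘(ℝ, F) e p).IsInvertible) (w : F) :
    mfderiv (𝓡 k) 𝓘(ℝ, F) e p (coordField e w p) = w :=
  hi.self_apply_inverse w

theorem mfderiv_coord_comp {e : N → F} {e' : N → F'} {τ : F → F'} {p : N}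
    (he : MDifferentiableAt (𝓡 k) 𝓘(ℝ, F) e p) (hτ : DifferentiableAt ℝ τ (e p))
    (h : e' =ᶠ[𝓝 p] τ ∘ e) :
    mfderiv (𝓡 k) 𝓘(ℝ, F') e' p = fderiv ℝ τ (e p) ∘L mfderiv (𝓡 k) 𝓘(ℝ, F) e p := by
  rw [h.mfderiv_eq, mfderiv_comp p hτ.mdifferentiableAt he, mfderiv_eq_fderiv]
  rfl

theorem fderiv_transition_isInvertible {e : N → F} {e' : N → F'} {τ : F → F'} {p : N}
    (he : MDifferentiableAt (𝓡 k) 𝓘(ℝ, F) e p) (hi : (mfderiv (𝓡 k) 𝓘(ℝ, F) e p).IsInvertible)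
    (hi' : (mfderiv (𝓡 k) 𝓘(ℝ, F') e' p).IsInvertible) (hτ : DifferentiableAt ℝ τ (e p))
    (h : e' =ᶠ[𝓝 p] τ ∘ e) : (fderiv ℝ τ (e p)).IsInvertible := by
  have h1 := mfderiv_coord_comp he hτ h
  obtain ⟨A, hA⟩ := hi
  obtain ⟨B, hB⟩ := hi'
  -- Tangent spaces are replaced by the model space they unfold to, so that `Dτ = De' ∘ De⁻¹` can be
  -- written as a composite of equivalences.
  let A' : Eu k ≃L[ℝ] F := A
  let B' : Eu k ≃L[ℝ] F' := B
  have hA' : (A' : Eu k →L[ℝ] F) = mfderiv (𝓡 k) 𝓘(ℝ, F) e p := hA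
  have hB' : (B' : Eu k →L[ℝ] F') = mfderiv (𝓡 k) 𝓘(ℝ, F') e' p := hB
  refine ⟨A'.symm.trans B', ?_⟩
  ext y
  have h2 := congrArg (fun T : Eu k →L[ℝ] F' => T (A'.symm y)) (hB'.trans h1)
  have h3 : mfderiv (𝓡 k) 𝓘(ℝ, F) e p (A'.symm y) = y := by
    refine (congrArg (fun T : Eu k →L[ℝ] F => T (A'.symm y)) hA').symm.trans ?_
    exact A'.apply_symm_apply y
  refine h2.trans ?_
  exact congrArg (fderiv ℝ τ (e p)) h3

variable [IsManifold (𝓡 k) ∞ N]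

/-- Differentiability of the sum is carried along because additivity of the covariant derivative
requires it of each partial sum. -/
theorem TorsionFreeConnection.cov_finset_sum (Γ : TorsionFreeConnection k N) {ι : Type*}
    (s : Finset ι) (g : ι → N → ℝ) (σ : ι → Π q : N, TangentSpace (𝓡 k) q) {p : N}
    (hg : ∀ i, MDifferentiableAt (𝓡 k) 𝓘(ℝ, ℝ) (g i) p)
    (hσ : ∀ i, MDifferentiableAt (𝓡 k) ((𝓡 k).prod (𝓡 k))
      (fun q => (⟨q, σ i q⟩ : Bundle.TotalSpace (Eu k) (TangentSpace (𝓡 k)))) p)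
    (X : TangentSpace (𝓡 k) p) :
    MDifferentiableAt (𝓡 k) ((𝓡 k).prod (𝓡 k))
      (fun q => (⟨q, (∑ i ∈ s, g i • σ i) q⟩ :
        Bundle.TotalSpace (Eu k) (TangentSpace (𝓡 k)))) p ∧
    Γ.cov (∑ i ∈ s, g i • σ i) p X =
      ∑ i ∈ s, (g i p • Γ.cov (σ i) p X + mvfderiv (𝓡 k) (g i) p X • σ i p) := by
  classical
  induction s using Finset.induction_on with
  | empty =>
    refine ⟨?_, ?_⟩
    · simp only [Finset.sum_empty]
      exact Bundle.mdifferentiableAt_zeroSection ..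
    · rw [Finset.sum_empty, Γ.cov.zero]
      simp
  | insert i s hi ih =>
    have h1 := (hg i).smul_section (hσ i)
    rw [Finset.sum_insert hi, Finset.sum_insert hi]
    refine ⟨mdifferentiableAt_add_section h1 ih.1, ?_⟩
    rw [Γ.cov.isCovariantDerivativeOnUniv.add h1 ih.1,
      Γ.cov.isCovariantDerivativeOnUniv.leibniz (hσ i) (hg i), ← ih.2]
    rfl

/-- The transformation law of the Christoffel symbols under a change `e' = τ ∘ e` of coordinates. -/
theorem christoffel_transition [FiniteDimensional ℝ F] [FiniteDimensional ℝ F']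
    (Γ : TorsionFreeConnection k N)
    {e : N → F} {e' : N → F'} {τ : F → F'} {p : N}
    (he : ContMDiffAt (𝓡 k) 𝓘(ℝ, F) ∞ e p) (hi : (mfderiv (𝓡 k) 𝓘(ℝ, F) e p).IsInvertible)
    (he' : ContMDiffAt (𝓡 k) 𝓘(ℝ, F') ∞ e' p)
    (hi' : (mfderiv (𝓡 k) 𝓘(ℝ, F') e' p).IsInvertible)
    (hτ : ContDiffAt ℝ 2 τ (e p)) (h : e' =ᶠ[𝓝 p] τ ∘ e) (v w : F) :
    fderiv ℝ τ (e p) (christoffel Γ e p v w) =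
      christoffel Γ e' p (fderiv ℝ τ (e p) v) (fderiv ℝ τ (e p) w) +
        fderiv ℝ (fderiv ℝ τ) (e p) v w := by
  have : CompleteSpace F := FiniteDimensional.complete ℝ F
  have hed : MDifferentiableAt (𝓡 k) 𝓘(ℝ, F) e p := he.mdifferentiableAt (by simp)
  have hτd : DifferentiableAt ℝ τ (e p) := hτ.differentiableAt (by simp)
  have hτi := fderiv_transition_isInvertible hed hi hi' hτd h
  have hτc : ContDiffAt ℝ 1 (fderiv ℝ τ) (e p) := hτ.fderiv_right (m := 1) (by norm_num)
  have hinv : ∀ᶠ y in 𝓝 (e p), (fderiv ℝ τ y).IsInvertible := by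
    obtain ⟨T, hT⟩ := hτi
    exact hτc.continuousAt (hT ▸ T.nhds)
  -- The functions `g i` are the components of the old coordinate field `∂_w` in the new coordinate
  -- frame: at `q` they are the coordinates of `Dτ(e q) w`.
  let b := Module.finBasis ℝ F'
  let ℓ := fun i => LinearMap.toContinuousLinearMap (b.coord i)
  let g := fun i (q : N) => ℓ i (fderiv ℝ τ (e q) w)
  have hDw : MDifferentiableAt (𝓡 k) 𝓘(ℝ, F') (fun q => fderiv ℝ τ (e q) w) p := by
    have h1 : DifferentiableAt ℝ (fun y => fderiv ℝ τ y w) (e p) :=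
      (hτc.differentiableAt (by simp)).clm_apply (differentiableAt_const w)
    exact h1.mdifferentiableAt.comp p hed
  have hg : ∀ i, MDifferentiableAt (𝓡 k) 𝓘(ℝ, ℝ) (g i) p := fun i =>
    (ℓ i).differentiableAt.mdifferentiableAt.comp p hDw
  have hdg : ∀ i, mvfderiv (𝓡 k) (g i) p (coordField e v p) =
      ℓ i (fderiv ℝ (fderiv ℝ τ) (e p) v w) := by
    intro i
    have h1 : DifferentiableAt ℝ (fun y => ℓ i (fderiv ℝ τ y w)) (e p) :=
      (ℓ i).differentiableAt.comp _
        ((hτc.differentiableAt (by simp)).clm_apply (differentiableAt_const w))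
    have h2 := mfderiv_coord_comp (e' := g i) hed h1 (EventuallyEq.refl _ _)
    have h3 : fderiv ℝ (fun y => ℓ i (fderiv ℝ τ y w)) (e p) v =
        ℓ i (fderiv ℝ (fderiv ℝ τ) (e p) v w) := by
      have h4 := ((ℓ i).hasFDerivAt (x := fderiv ℝ τ (e p) w)).comp (e p)
        ((hτc.differentiableAt (by simp)).hasFDerivAt.clm_apply (hasFDerivAt_const w (e p)))
      rw [show (fun y => ℓ i (fderiv ℝ τ y w)) = ℓ i ∘ fun y => fderiv ℝ τ y w from rfl,
        h4.fderiv]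
      simp
    rw [← h3]
    refine (congrArg (fun T : Eu k →L[ℝ] ℝ => T (coordField e v p)) h2).trans ?_
    exact congrArg (fderiv ℝ (fun y => ℓ i (fderiv ℝ τ y w)) (e p)) (mfderiv_coordField hi v)
  let σ : Fin (Module.finrank ℝ F') → Π q : N, TangentSpace (𝓡 k) q := fun i => coordField e' (b i)
  -- The frame expansion holds near `p`, not only at `p`, so it may be differentiated; at each
  -- nearby `q` it is `De'⁻¹ = De⁻¹ ∘ Dτ⁻¹` applied to `Dτ w`.
  have hfield : ∀ᶠ q in 𝓝 p, coordField e w q = (∑ i, g i • σ i) q := by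
    have hn : ∀ᶠ q in 𝓝 p, ContMDiffAt (𝓡 k) 𝓘(ℝ, F) 1 e q :=
      (contMDiffAt_iff_contMDiffAt_nhds (by simp)).1 (he.of_le (by simp))
    filter_upwards [hn, h.eventually_nhds, he.continuousAt.eventually hinv,
      he.continuousAt.eventually (hτ.eventually (by simp))] with q h1 h2 h3 h4
    have h5 := mfderiv_coord_comp (h1.mdifferentiableAt (by simp))
      (h4.differentiableAt (by simp)) h2
    let A : Eu k →L[ℝ] F := mfderiv (𝓡 k) 𝓘(ℝ, F) e q
    have h6 : ∀ y, @Eq (Eu k) (coordField e' y q) (A.inverse ((fderiv ℝ τ (e q)).inverse y)) := by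
      intro y
      refine Eq.trans ?_ (ContinuousLinearMap.IsInvertible.inverse_comp_apply_of_left h3)
      exact congrArg (fun T : Eu k →L[ℝ] F' => T.inverse y) h5
    have h7 : @Eq (Eu k) (coordField e w q) (A.inverse w) := rfl
    rw [Finset.sum_apply]
    refine h7.trans ?_
    have h8 : ∀ i, @Eq (Eu k) ((g i • σ i) q)
        (A.inverse ((fderiv ℝ τ (e q)).inverse (g i q • b i))) := by
      intro i
      rw [map_smul, map_smul, ← h6]
      rfl
    refine Eq.trans ?_ (Finset.sum_congr rfl fun i _ => (h8 i).symm)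
    refine Eq.trans ?_ (map_sum (A.inverse ∘L (fderiv ℝ τ (e q)).inverse)
      (fun i => g i q • b i) Finset.univ)
    have h9 : ∑ i, g i q • b i = fderiv ℝ τ (e q) w := b.sum_repr _
    rw [h9, ContinuousLinearMap.comp_apply, h3.inverse_apply_self]
  obtain ⟨hs1, hs2⟩ := Γ.cov_finset_sum Finset.univ g σ hg
    (fun i => mdiff_coordField he' hi' (b i)) (coordField e v p)
  have hcov := Γ.cov.isCovariantDerivativeOnUniv.congr_of_eventuallyEq
    (mdiff_coordField he hi w) hs1 univ_mem hfield
  have hm := mfderiv_coord_comp hed hτd h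
  have hX : (coordField e v p : TangentSpace (𝓡 k) p) = coordField e' (fderiv ℝ τ (e p) v) p := by
    apply hi'.injective
    rw [mfderiv_coordField hi']
    refine (congrArg (fun T : Eu k →L[ℝ] F' => T (coordField e v p)) hm).trans ?_
    exact congrArg (fderiv ℝ τ (e p)) (mfderiv_coordField hi v)
  let G : F' →ₗ[ℝ] F' :=
    { toFun := christoffel Γ e' p (fderiv ℝ τ (e p) v)
      map_add' := christoffel_add_right Γ he' hi' _
      map_smul' := fun c => christoffel_smul_right Γ he' hi' c _ }
  have hG : ∀ y, mfderiv (𝓡 k) 𝓘(ℝ, F') e' p (Γ.cov (coordField e' y) p (coordField e v p)) =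
      G y := by
    intro y
    rw [hX]
    rfl
  -- The Leibniz rule splits the derivative in two: the terms with `G` reassemble to the new
  -- Christoffel symbol by linearity, and the derivatives of the `g i` reassemble to `D²τ(v, w)`.
  have hsum : fderiv ℝ τ (e p) (christoffel Γ e p v w) =
      ∑ i, (g i p • G (b i) + ℓ i (fderiv ℝ (fderiv ℝ τ) (e p) v w) • b i) := by
    have h1 : fderiv ℝ τ (e p) (christoffel Γ e p v w) =
        mfderiv (𝓡 k) 𝓘(ℝ, F') e' p (Γ.cov (coordField e w) p (coordField e v p)) :=
      (congrArg (fun T : Eu k →L[ℝ] F' => T (Γ.cov (coordField e w) p (coordField e v p)))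
        hm).symm
    rw [h1, hcov, hs2]
    refine (map_sum (mfderiv (𝓡 k) 𝓘(ℝ, F') e' p) _ _).trans ?_
    refine Finset.sum_congr rfl fun i _ => ?_
    refine (map_add (mfderiv (𝓡 k) 𝓘(ℝ, F') e' p) _ _).trans ?_
    refine congrArg₂ (· + ·) ?_ ?_
    · refine (map_smul (mfderiv (𝓡 k) 𝓘(ℝ, F') e' p) _ _).trans ?_
      rw [hG]
      rfl
    · refine (map_smul (mfderiv (𝓡 k) 𝓘(ℝ, F') e' p) _ _).trans ?_
      rw [hdg, mfderiv_coordField hi']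
      rfl
  rw [hsum, Finset.sum_add_distrib]
  refine congrArg₂ (· + ·) ?_ (b.sum_repr _)
  have h1 : ∑ i, g i p • b i = fderiv ℝ τ (e p) w := b.sum_repr _
  change _ = G (fderiv ℝ τ (e p) w)
  rw [← h1, map_sum]
  simp

end ChristoffelTransformation

/-! ### Parametrizations, graphs and tangent planes of submanifolds -/

section Submanifolds

variable {n m : ℕ} {E : Type*} [TopologicalSpace E] [ChartedSpace (Eu (n + m)) E]

theorem vertProj_horLift (P : Eu n →L[ℝ] Eu m) (a : Eu n) : vertProj P (horLift P a) = 0 := by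
  simp [vertProj, horLift]

theorem vertProj_add (P : Eu n →L[ℝ] Eu m) (y z : Eu n × Eu m) :
    vertProj P (y + z) = vertProj P y + vertProj P z := by
  simp [vertProj]; abel

theorem eq_horLift_of_vertProj_eq_zero {P : Eu n →L[ℝ] Eu m} {y : Eu n × Eu m}
    (h : vertProj P y = 0) : y = horLift P y.1 :=
  Prod.ext rfl (sub_eq_zero.1 h)

/-- The change of coordinates from a chart `φ` to a divided chart `u`. -/
def DividedChart.transition (u : DividedChart n m E) (φ : OpenPartialHomeomorph E (Eu (n + m))) :
    Eu (n + m) → Eu n × Eu m := u.coord ∘ φ.symm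

theorem DividedChart.transition_apply (u : DividedChart n m E)
    {φ : OpenPartialHomeomorph E (Eu (n + m))} {q : E} (hq : q ∈ φ.source) :
    u.transition φ (φ q) = u.coord q := by
  simp [transition, φ.left_inv hq]

theorem DividedChart.coord_eventuallyEq (u : DividedChart n m E)
    {φ : OpenPartialHomeomorph E (Eu (n + m))} {p : E} (hp : p ∈ φ.source) :
    u.coord =ᶠ[𝓝 p] u.transition φ ∘ φ := by
  filter_upwards [φ.open_source.mem_nhds hp] with q hq
  exact (u.transition_apply hq).symm

theorem DividedChart.continuousAt_coord (u : DividedChart n m E) {p : E}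
    (hp : p ∈ u.chart.source) : ContinuousAt u.coord p :=
  u.split.continuous.continuousAt.comp (u.chart.continuousAt hp)

theorem DividedChart.coord_injOn (u : DividedChart n m E) : InjOn u.coord u.chart.source :=
  fun _ hq _ hq' h => u.chart.injOn hq hq' (u.split.injective h)

/-- The graph of `g` in the divided chart `v`, in the chart underlying `v`. -/
def DividedChart.graphParam (v : DividedChart n m E) (g : Eu n → Eu m) (x : Eu n) : Eu (n + m) :=
  v.split.symm (x, g x)

theorem DividedChart.contDiffAt_graphParam (v : DividedChart n m E) {g : Eu n → Eu m} {x : Eu n}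
    {r : WithTop ℕ∞} (hg : ContDiffAt ℝ r g x) : ContDiffAt ℝ r (v.graphParam g) x :=
  v.split.symm.contDiff.contDiffAt.comp x (contDiffAt_id.prodMk hg)

theorem DividedChart.IsGraphAt.snd_eq {u : DividedChart n m E} {L : Set E} {p : E}
    {f : Eu n → Eu m} (hu : u.IsGraphAt L p f) (hp : p ∈ L) :
    (u.coord p).2 = f (u.coord p).1 :=
  hu.2.2.self_of_nhds.1 hp

theorem DividedChart.IsGraphAt.graphParam_base {v : DividedChart n m E} {L : Set E} {p : E}
    {g : Eu n → Eu m} (hv : v.IsGraphAt L p g) (hp : p ∈ L) :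
    v.graphParam g (v.coord p).1 = v.chart p := by
  rw [graphParam, ← hv.snd_eq hp]
  exact v.split.symm_apply_apply _

theorem fderiv_graph {f : Eu n → Eu m} {x : Eu n} (hf : DifferentiableAt ℝ f x) (b : Eu n) :
    fderiv ℝ (fun y => (y, f y)) x b = horLift (fderiv ℝ f x) b := by
  have := ((hasFDerivAt_id x).prodMk hf.hasFDerivAt).fderiv
  exact congrArg (fun T : Eu n →L[ℝ] Eu n × Eu m => T b) this

/-- The first component of the graph map is linear, hence disappears in the second derivative. -/
theorem fderiv_fderiv_graph {f : Eu n → Eu m} {x : Eu n} (hf : ContDiffAt ℝ 2 f x) (b a : Eu n) :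
    fderiv ℝ (fderiv ℝ fun y => (y, f y)) x b a = (0, fderiv ℝ (fderiv ℝ f) x b a) := by
  let ι := ContinuousLinearMap.inl ℝ (Eu n) (Eu m)
  let κ := ContinuousLinearMap.inr ℝ (Eu n) (Eu m)
  have h1 : fderiv ℝ (fun y => (y, f y)) =ᶠ[𝓝 x] fun y => ι + fderiv ℝ (κ ∘ f) y := by
    filter_upwards [hf.eventually (by simp)] with y hy
    have hd := hy.differentiableAt (by simp)
    ext b
    · simp [fderiv_graph hd, horLift, ι, fderiv_comp y κ.differentiableAt hd, κ]
    · simp [fderiv_graph hd, horLift, ι, fderiv_comp y κ.differentiableAt hd, κ]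
  rw [h1.fderiv_eq, fderiv_const_add, fderiv_fderiv_comp κ.contDiff.contDiffAt hf]
  have h2 : fderiv ℝ κ = fun _ => κ := funext fun _ => κ.fderiv
  simp [h2, κ]

/-- In the chart `φ`, the map `c` is near `x₀` an immersion into `L` which maps `x₀` to `p`. -/
structure IsLocalParam (φ : OpenPartialHomeomorph E (Eu (n + m))) (L : Set E) (p : E)
    (c : Eu n → Eu (n + m)) (x₀ : Eu n) : Prop where
  chart_mem : φ ∈ IsManifold.maximalAtlas (𝓡 (n + m)) ∞ E
  mem_source : p ∈ φ.source
  contDiffAt : ContDiffAt ℝ 2 c x₀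
  map_base : c x₀ = φ p
  injective : Function.Injective (fderiv ℝ c x₀)
  eventually_mem : ∀ᶠ x in 𝓝 x₀, φ.symm (c x) ∈ L

/-- A graph parametrizes itself. Two divided charts are compared by reading the parametrization from
one in the other. -/
theorem DividedChart.IsGraphAt.isLocalParam {v : DividedChart n m E} {L : Set E} {p : E}
    {g : Eu n → Eu m} (hv : v.IsGraphAt L p g) (hp : p ∈ L) :
    IsLocalParam v.chart L p (v.graphParam g) (v.coord p).1 := by
  have hg := hv.2.1.self_of_nhds
  have hc := v.contDiffAt_graphParam hg
  have hb := hv.graphParam_base hp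
  have ht : v.graphParam g (v.coord p).1 ∈ v.chart.target := hb ▸ v.chart.map_source hv.1
  refine ⟨v.chart_mem, hv.1, hc.of_le (by exact_mod_cast two_le_infty), hb, ?_, ?_⟩
  · have h1 : HasFDerivAt (v.graphParam g)
        ((v.split.symm : Eu n × Eu m →L[ℝ] Eu (n + m)) ∘L
          (ContinuousLinearMap.id ℝ (Eu n)).prod (fderiv ℝ g (v.coord p).1)) (v.coord p).1 :=
      v.split.symm.hasFDerivAt.comp _
        ((hasFDerivAt_id _).prodMk (hg.differentiableAt (by simp)).hasFDerivAt)
    rw [h1.fderiv]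
    intro a b hab
    exact congrArg Prod.fst (v.split.symm.injective hab)
  · have hcont : Tendsto (fun x => v.chart.symm (v.graphParam g x)) (𝓝 (v.coord p).1) (𝓝 p) := by
      have h1 := (v.chart.symm.continuousAt ht).comp hc.continuousAt
      have h2 : v.chart.symm (v.graphParam g (v.coord p).1) = p := by
        rw [hb, v.chart.left_inv hv.1]
      simpa only [ContinuousAt, Function.comp, h2] using! h1
    filter_upwards [hcont.eventually hv.2.2,
      hc.continuousAt.eventually (v.chart.open_target.mem_nhds ht)] with x h1 h2
    refine h1.2 ?_
    have h3 : v.coord (v.chart.symm (v.graphParam g x)) = (x, g x) := by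
      rw [coord, v.chart.right_inv h2]
      exact v.split.apply_symm_apply _
    rw [h3]

variable [IsManifold (𝓡 (n + m)) ∞ E]

theorem DividedChart.contDiffAt_transition (u : DividedChart n m E)
    {φ : OpenPartialHomeomorph E (Eu (n + m))} (hφ : φ ∈ IsManifold.maximalAtlas (𝓡 (n + m)) ∞ E)
    {y : Eu (n + m)} (hy : y ∈ φ.target) (hu : φ.symm y ∈ u.chart.source) :
    ContDiffAt ℝ ∞ (u.transition φ) y :=
  ((u.contMDiffAt hu).comp y (contMDiffAt_symm_of_mem_maximalAtlas hφ hy)).contDiffAt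

theorem DividedChart.mfderiv_coord (u : DividedChart n m E)
    {φ : OpenPartialHomeomorph E (Eu (n + m))} (hφ : φ ∈ IsManifold.maximalAtlas (𝓡 (n + m)) ∞ E)
    {p : E} (hp : p ∈ φ.source) (hu : p ∈ u.chart.source) :
    mfderiv (𝓡 (n + m)) 𝓘(ℝ, Eu n × Eu m) u.coord p =
      fderiv ℝ (u.transition φ) (φ p) ∘L mfderiv (𝓡 (n + m)) 𝓘(ℝ, Eu (n + m)) φ p :=
  mfderiv_coord_comp ((contMDiffAt_of_mem_maximalAtlas hφ hp).mdifferentiableAt (by simp))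
    ((u.contDiffAt_transition hφ (φ.map_source hp) (by rwa [φ.left_inv hp])).differentiableAt
      (by simp)) (u.coord_eventuallyEq hp)

theorem DividedChart.isInvertible_fderiv_transition (u : DividedChart n m E)
    {φ : OpenPartialHomeomorph E (Eu (n + m))} (hφ : φ ∈ IsManifold.maximalAtlas (𝓡 (n + m)) ∞ E)
    {p : E} (hp : p ∈ φ.source) (hu : p ∈ u.chart.source) :
    (fderiv ℝ (u.transition φ) (φ p)).IsInvertible :=
  fderiv_transition_isInvertible
    ((contMDiffAt_of_mem_maximalAtlas hφ hp).mdifferentiableAt (by simp))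
    (chart_mfderiv_isInvertible hφ hp) (u.isInvertible hu)
    ((u.contDiffAt_transition hφ (φ.map_source hp) (by rwa [φ.left_inv hp])).differentiableAt
      (by simp)) (u.coord_eventuallyEq hp)

/-- A parametrization of `L` in the chart `φ` and the description of `L` as a graph in the divided
chart `u` are related by a change of parameters with first derivative `A` and second derivative
`B`. -/
theorem IsLocalParam.exists_reparam {φ : OpenPartialHomeomorph E (Eu (n + m))} {L : Set E} {p : E}
    {c : Eu n → Eu (n + m)} {x₀ : Eu n} (hc : IsLocalParam φ L p c x₀)
    {u : DividedChart n m E} {f : Eu n → Eu m} (hu : u.IsGraphAt L p f) :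
    ∃ (A : Eu n →L[ℝ] Eu n) (B : Eu n → Eu n → Eu n), Function.Surjective A ∧
      (∀ b, fderiv ℝ (u.transition φ) (φ p) (fderiv ℝ c x₀ b) =
        horLift (fderiv ℝ f (u.coord p).1) (A b)) ∧
      ∀ b a, fderiv ℝ (fderiv ℝ (u.transition φ)) (φ p) (fderiv ℝ c x₀ b) (fderiv ℝ c x₀ a) +
          fderiv ℝ (u.transition φ) (φ p) (fderiv ℝ (fderiv ℝ c) x₀ b a) =
        (0, fderiv ℝ (fderiv ℝ f) (u.coord p).1 (A b) (A a)) +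
          horLift (fderiv ℝ f (u.coord p).1) (B b a) := by
  set τ := u.transition φ
  have hpt := φ.map_source hc.mem_source
  have hτ : ContDiffAt ℝ 2 τ (c x₀) := by
    rw [hc.map_base]
    exact (u.contDiffAt_transition hc.chart_mem hpt
      (by rw [φ.left_inv hc.mem_source]; exact hu.1)).of_le (by exact_mod_cast two_le_infty)
  have hτc : ContDiffAt ℝ 2 (τ ∘ c) x₀ := hτ.comp x₀ hc.contDiffAt
  let h₁ := fun x => (τ (c x)).1
  have hh₁ : ContDiffAt ℝ 2 h₁ x₀ := contDiff_fst.contDiffAt.comp x₀ hτc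
  have hb : h₁ x₀ = (u.coord p).1 := by
    simp only [h₁, hc.map_base, τ, u.transition_apply hc.mem_source]
  have hf : ContDiffAt ℝ 2 f (h₁ x₀) := by
    rw [hb]
    exact hu.2.1.self_of_nhds.of_le (by exact_mod_cast two_le_infty)
  let k := fun y => (y, f y)
  have hk : ContDiffAt ℝ 2 k (h₁ x₀) := contDiffAt_id.prodMk hf
  -- Near `x₀` the map `c` lands in `L`, so in the coordinates of `u` it lies on the graph of `f`
  -- and is determined by its first component `h₁`, the change of parameters.
  have heq : τ ∘ c =ᶠ[𝓝 x₀] k ∘ h₁ := by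
    have hcont : Tendsto (fun x => φ.symm (c x)) (𝓝 x₀) (𝓝 p) := by
      have h1 := (φ.symm.continuousAt (hc.map_base ▸ hpt)).comp hc.contDiffAt.continuousAt
      have h2 : φ.symm (c x₀) = p := by rw [hc.map_base, φ.left_inv hc.mem_source]
      simpa only [ContinuousAt, Function.comp, h2] using! h1
    filter_upwards [hc.eventually_mem, hcont.eventually hu.2.2] with x h1 h2
    exact Prod.ext rfl (h2.1 h1)
  have hd1 : ∀ b, fderiv ℝ τ (φ p) (fderiv ℝ c x₀ b) =
      horLift (fderiv ℝ f (u.coord p).1) (fderiv ℝ h₁ x₀ b) := by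
    intro b
    rw [← hc.map_base, ← hb, ← fderiv_graph (hf.differentiableAt (by simp))]
    have h3 := heq.fderiv_eq (𝕜 := ℝ)
    rw [fderiv_comp x₀ (hτ.differentiableAt (by simp)) (hc.contDiffAt.differentiableAt (by simp)),
      fderiv_comp x₀ (hk.differentiableAt (by simp)) (hh₁.differentiableAt (by simp))] at h3
    exact congrArg (fun T => T b) h3
  refine ⟨fderiv ℝ h₁ x₀, fun b a => fderiv ℝ (fderiv ℝ h₁) x₀ b a, ?_, hd1, fun b a => ?_⟩
  -- `Dh₁` is injective because `Dτ ∘ Dc` is and factors through it; an injective endomorphism of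
  -- `ℝⁿ` is surjective.
  · refine (isInvertible_of_injective rfl ?_).surjective
    intro a b hab
    refine hc.injective
      ((u.isInvertible_fderiv_transition hc.chart_mem hc.mem_source hu.1).injective ?_)
    rw [hd1, hd1, hab]
  -- Both sides are the second derivative of the same germ, written once as `τ ∘ c` and once as `k ∘
  -- h₁`.
  · rw [← hc.map_base, ← hb, ← fderiv_fderiv_graph hf, ← fderiv_graph (hf.differentiableAt (by simp)),
      ← fderiv_fderiv_comp hτ hc.contDiffAt, ← fderiv_fderiv_comp hk hh₁, heq.fderiv.fderiv_eq]

/-- The tangent plane at `p` of the graph of `f` in the divided chart `u`. -/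
def DividedChart.tangentPlane (u : DividedChart n m E) (f : Eu n → Eu m) (p : E) :
    Set (Eu (n + m)) :=
  {y | vertProj (fderiv ℝ f (u.coord p).1)
    (mfderiv (𝓡 (n + m)) 𝓘(ℝ, Eu n × Eu m) u.coord p y) = 0}

theorem IsLocalParam.mem_range_iff {φ : OpenPartialHomeomorph E (Eu (n + m))} {L : Set E} {p : E}
    {c : Eu n → Eu (n + m)} {x₀ : Eu n} (hc : IsLocalParam φ L p c x₀)
    {u : DividedChart n m E} {f : Eu n → Eu m} (hu : u.IsGraphAt L p f) (y : Eu (n + m)) :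
    y ∈ range (fderiv ℝ c x₀) ↔
      vertProj (fderiv ℝ f (u.coord p).1) (fderiv ℝ (u.transition φ) (φ p) y) = 0 := by
  obtain ⟨A, -, hA, hd, -⟩ := hc.exists_reparam hu
  constructor
  · rintro ⟨b, rfl⟩
    rw [hd, vertProj_horLift]
  · intro h
    obtain ⟨b, hb⟩ := hA (fderiv ℝ (u.transition φ) (φ p) y).1
    refine ⟨b, (u.isInvertible_fderiv_transition hc.chart_mem hc.mem_source hu.1).injective ?_⟩
    rw [hd, hb, ← eq_horLift_of_vertProj_eq_zero h]

/-- The left side does not involve `φ` and `c`, the right side does not involve `u` and `f`. Hence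
the tangent plane depends neither on the divided chart nor on the parametrization. -/
theorem IsLocalParam.mem_tangentPlane_iff {φ : OpenPartialHomeomorph E (Eu (n + m))} {L : Set E}
    {p : E} {c : Eu n → Eu (n + m)} {x₀ : Eu n} (hc : IsLocalParam φ L p c x₀)
    {u : DividedChart n m E} {f : Eu n → Eu m} (hu : u.IsGraphAt L p f) (y : Eu (n + m)) :
    y ∈ u.tangentPlane f p ↔
      (mfderiv (𝓡 (n + m)) 𝓘(ℝ, Eu (n + m)) φ p : Eu (n + m) →L[ℝ] Eu (n + m)) y ∈
        range (fderiv ℝ c x₀) := by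
  refine Iff.trans ?_ (hc.mem_range_iff hu _).symm
  have h := congrArg (fun T : Eu (n + m) →L[ℝ] Eu n × Eu m => T y)
    (u.mfderiv_coord hc.chart_mem hc.mem_source hu.1)
  exact iff_of_eq (congrArg (fun z => vertProj (fderiv ℝ f (u.coord p).1) z = 0) h)

theorem DividedChart.IsGraphAt.tangentPlane_eq {u v : DividedChart n m E} {L : Set E} {p : E}
    {f g : Eu n → Eu m} (hu : u.IsGraphAt L p f) (hv : v.IsGraphAt L p g) (hp : p ∈ L) :
    u.tangentPlane f p = v.tangentPlane g p := by
  ext y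
  rw [(hv.isLocalParam hp).mem_tangentPlane_iff hu, (hv.isLocalParam hp).mem_tangentPlane_iff hv]

/-- The equation of horizontality of a graph in terms of a parametrization. -/
theorem IsLocalParam.dotVertical_eq (Γ : TorsionFreeConnection (n + m) E)
    {φ : OpenPartialHomeomorph E (Eu (n + m))} {L : Set E}
    {p : E} {c : Eu n → Eu (n + m)} {x₀ : Eu n} (hc : IsLocalParam φ L p c x₀)
    {u : DividedChart n m E} {f : Eu n → Eu m} (hu : u.IsGraphAt L p f) :
    (∀ b a, dotVertical Γ u p (fderiv ℝ f (u.coord p).1) (horLift (fderiv ℝ f (u.coord p).1) b)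
      (fderiv ℝ (fderiv ℝ f) (u.coord p).1 b) a = 0) ↔
    ∀ b a, fderiv ℝ (fderiv ℝ c) x₀ b a +
      christoffel Γ φ p (fderiv ℝ c x₀ b) (fderiv ℝ c x₀ a) ∈ range (fderiv ℝ c x₀) := by
  obtain ⟨A, B, hA, hd, hdd⟩ := hc.exists_reparam hu
  -- The term `D²τ(Dc b, Dc a)` from the Christoffel law completes `Dτ(D²c)` to the second
  -- derivative of `τ ∘ c`. The reparametrization term `horLift (B b a)` is tangent, and `vertProj`
  -- kills it.
  have key : ∀ b a, vertProj (fderiv ℝ f (u.coord p).1) (fderiv ℝ (u.transition φ) (φ p)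
      (fderiv ℝ (fderiv ℝ c) x₀ b a +
        christoffel Γ φ p (fderiv ℝ c x₀ b) (fderiv ℝ c x₀ a))) =
      dotVertical Γ u p (fderiv ℝ f (u.coord p).1)
        (horLift (fderiv ℝ f (u.coord p).1) (A b))
        (fderiv ℝ (fderiv ℝ f) (u.coord p).1 (A b)) (A a) := by
    intro b a
    rw [map_add, christoffel_transition Γ (contMDiffAt_of_mem_maximalAtlas hc.chart_mem
      hc.mem_source) (chart_mfderiv_isInvertible hc.chart_mem hc.mem_source) (u.contMDiffAt hu.1)
      (u.isInvertible hu.1)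
      ((u.contDiffAt_transition hc.chart_mem (φ.map_source hc.mem_source)
        (by rw [φ.left_inv hc.mem_source]; exact hu.1)).of_le (by exact_mod_cast two_le_infty))
      (u.coord_eventuallyEq hc.mem_source), add_comm, add_assoc, hdd, hd, hd, dotVertical,
      ← add_assoc, vertProj_add, vertProj_horLift, add_zero, add_comm]
  simp only [hc.mem_range_iff hu, key]
  refine ⟨fun h b a => h _ _, fun h b a => ?_⟩
  obtain ⟨b, rfl⟩ := hA b
  obtain ⟨a, rfl⟩ := hA a
  exact h b a

end Submanifolds

/-! ### Jets of submanifolds: invariants and uniqueness of the horizontal jet -/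

section ContactOfSubmanifolds

variable {n m : ℕ} {E : Type*} [TopologicalSpace E] [ChartedSpace (Eu (n + m)) E]

theorem SubJet.pt_eq_of_mk_eq {r : ℕ} {P P' : PointedSubmanifold n m E}
    (h : SubJet.mk r P = SubJet.mk r P') : P.pt = P'.pt :=
  congrArg (Quot.lift PointedSubmanifold.pt fun _ _ h => h.1) h

theorem HasContact.symm {r : ℕ} {P P' : PointedSubmanifold n m E} (h : HasContact r P P') :
    HasContact r P' P := by
  obtain ⟨hp, u, f, f', hf, hf', hd⟩ := h
  rw [hp] at hf hf' hd
  exact ⟨hp.symm, u, f', f, hf', hf, fun k hk => (hd k hk).symm⟩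

variable [IsManifold (𝓡 (n + m)) ∞ E]

/-- A submanifold tangent at `p` to a graph in the divided chart `u` is itself a graph in `u`. -/
theorem DividedChart.IsGraphAt.exists_graph_of_tangentPlane_eq {u v : DividedChart n m E}
    {L L' : Set E} {p : E} {f g : Eu n → Eu m} (hu : u.IsGraphAt L p f) (hv : v.IsGraphAt L' p g)
    (hp : p ∈ L) (hp' : p ∈ L') (ht : u.tangentPlane f p = v.tangentPlane g p) :
    ∃ f', u.IsGraphAt L' p f' ∧ f (u.coord p).1 = f' (u.coord p).1 ∧
      fderiv ℝ f (u.coord p).1 = fderiv ℝ f' (u.coord p).1 := by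
  have hc := hv.isLocalParam hp'
  set x₀ := (v.coord p).1
  set c := v.graphParam g
  set τ := u.transition v.chart
  set P := fderiv ℝ f (u.coord p).1
  have hcx : c x₀ = v.chart p := hc.map_base
  have hcont : Tendsto (fun x => v.chart.symm (c x)) (𝓝 x₀) (𝓝 p) := by
    have h1 := (v.chart.symm.continuousAt (hcx ▸ v.chart.map_source hv.1)).comp
      hc.contDiffAt.continuousAt
    have h2 : v.chart.symm (c x₀) = p := by rw [hcx, v.chart.left_inv hv.1]
    simpa only [ContinuousAt, Function.comp, h2] using! h1
  have hK : ∀ᶠ x in 𝓝 x₀, ContDiffAt ℝ ∞ (τ ∘ c) x := by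
    filter_upwards [hv.2.1, hcont.eventually (u.chart.open_source.mem_nhds hu.1),
      hc.contDiffAt.continuousAt.eventually
        (v.chart.open_target.mem_nhds (hcx ▸ v.chart.map_source hv.1))] with x h1 h2 h3
    exact (u.contDiffAt_transition v.chart_mem h3 h2).comp x (v.contDiffAt_graphParam h1)
  have hKx : (τ ∘ c) x₀ = u.coord p := by
    simp only [Function.comp, hcx, τ, u.transition_apply hv.1]
  have hτd : DifferentiableAt ℝ τ (c x₀) := by
    rw [hcx]
    exact (u.contDiffAt_transition v.chart_mem (v.chart.map_source hv.1)
      (by rw [v.chart.left_inv hv.1]; exact hu.1)).differentiableAt (by simp)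
  have hdK : ∀ b, fderiv ℝ (τ ∘ c) x₀ b = fderiv ℝ τ (v.chart p) (fderiv ℝ c x₀ b) := by
    intro b
    rw [fderiv_comp x₀ hτd (hc.contDiffAt.differentiableAt (by simp)), hcx]
    rfl
  -- This is where tangency enters: the parametrization `c` of `L'`, read in `u`, has its
  -- differential in the tangent plane of the graph of `f`.
  have hlift : ∀ b, (fderiv ℝ (τ ∘ c) x₀ b).2 = P (fderiv ℝ (τ ∘ c) x₀ b).1 := by
    intro b
    obtain ⟨y, hy⟩ := (chart_mfderiv_isInvertible v.chart_mem hv.1).surjective (fderiv ℝ c x₀ b)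
    have h1 : y ∈ v.tangentPlane g p := (hc.mem_tangentPlane_iff hv y).2 ⟨b, hy.symm⟩
    rw [← ht] at h1
    have h2 : fderiv ℝ (τ ∘ c) x₀ b =
        mfderiv (𝓡 (n + m)) 𝓘(ℝ, Eu n × Eu m) u.coord p y := by
      rw [hdK]
      refine (congrArg (fderiv ℝ τ (v.chart p)) hy).symm.trans ?_
      exact congrArg (fun T : Eu (n + m) →L[ℝ] Eu n × Eu m => T y)
        (u.mfderiv_coord v.chart_mem hv.1 hu.1).symm
    rw [h2]
    exact sub_eq_zero.1 h1
  have hKd : DifferentiableAt ℝ (τ ∘ c) x₀ := hK.self_of_nhds.differentiableAt (by simp)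
  let k₁ := fun x => (τ (c x)).1
  let k₂ := fun x => (τ (c x)).2
  have hk₁ : ∀ᶠ x in 𝓝 x₀, ContDiffAt ℝ ∞ k₁ x :=
    hK.mono fun x hx => contDiff_fst.contDiffAt.comp x hx
  have hk₂ : ∀ᶠ x in 𝓝 x₀, ContDiffAt ℝ ∞ k₂ x :=
    hK.mono fun x hx => contDiff_snd.contDiffAt.comp x hx
  have hd₁ : ∀ b, fderiv ℝ k₁ x₀ b = (fderiv ℝ (τ ∘ c) x₀ b).1 := fun b =>
    congrArg (fun T : Eu n →L[ℝ] Eu n => T b) hKd.hasFDerivAt.fst.fderiv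
  have hd₂ : ∀ b, fderiv ℝ k₂ x₀ b = (fderiv ℝ (τ ∘ c) x₀ b).2 := fun b =>
    congrArg (fun T : Eu n →L[ℝ] Eu m => T b) hKd.hasFDerivAt.snd.fderiv
  -- The second component of `D(τ ∘ c)` is a function of the first, so injectivity of the
  -- differential passes to the first component `k₁`. Its local inverse gives the graph function `k₂
  -- ∘ k₁⁻¹`.
  have hinv : (fderiv ℝ k₁ x₀).IsInvertible := by
    refine isInvertible_of_injective rfl fun a b hab => hc.injective ?_
    refine (u.isInvertible_fderiv_transition v.chart_mem hv.1 hu.1).injective ?_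
    rw [← hdK, ← hdK]
    rw [hd₁, hd₁] at hab
    exact Prod.ext hab (by rw [hlift, hlift, hab])
  obtain ⟨Φ, hx₀, hΦ, hΦs, hΦt⟩ := exists_openPartialHomeomorph hk₁ hinv
  have hk₁x : Φ x₀ = (u.coord p).1 := by rw [hΦ]; exact congrArg Prod.fst hKx
  have hsymm : Φ.symm (u.coord p).1 = x₀ := by rw [← hk₁x, Φ.left_inv hx₀]
  have hmem : (u.coord p).1 ∈ Φ.target := hk₁x ▸ Φ.map_source hx₀
  have hback : Tendsto Φ.symm (𝓝 (u.coord p).1) (𝓝 x₀) := by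
    have := Φ.symm.continuousAt hmem
    rwa [ContinuousAt, hsymm] at this
  have hval : k₂ x₀ = f (u.coord p).1 := by
    rw [← hu.snd_eq hp]; exact congrArg Prod.snd hKx
  have hf' : ∀ᶠ y in 𝓝 (u.coord p).1, ContDiffAt ℝ ∞ (k₂ ∘ Φ.symm) y := by
    filter_upwards [Φ.open_target.mem_nhds hmem, hback.eventually hk₂] with y h1 h2
    exact h2.comp y (hΦt y h1)
  have hcoord : Tendsto (fun q => (u.coord q).1) (𝓝 p) (𝓝 (u.coord p).1) :=
    (continuous_fst.tendsto _).comp (u.continuousAt_coord hu.1)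
  have hcoord' : Tendsto (fun q => (v.coord q).1) (𝓝 p) (𝓝 x₀) :=
    (continuous_fst.tendsto _).comp (v.continuousAt_coord hv.1)
  refine ⟨k₂ ∘ Φ.symm, ⟨hu.1, hf', ?_⟩, ?_, ?_⟩
  · filter_upwards [hv.2.2, u.chart.open_source.mem_nhds hu.1, v.chart.open_source.mem_nhds hv.1,
      hcoord'.eventually (Φ.open_source.mem_nhds hx₀), hcoord.eventually (Φ.open_target.mem_nhds hmem),
      (hback.comp hcoord).eventually hc.eventually_mem,
      (hback.comp hcoord).eventually (hcont.eventually (u.chart.open_source.mem_nhds hu.1))]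
      with q h1 hqu hqv h2 h3 h4 h5
    constructor
    · intro hq
      have h6 : c (v.coord q).1 = v.chart q := by
        have : ((v.coord q).1, g (v.coord q).1) = v.coord q := Prod.ext rfl (h1.1 hq).symm
        simp only [c, DividedChart.graphParam, this]
        exact v.split.symm_apply_apply _
      have h7 : τ (c (v.coord q).1) = u.coord q := by rw [h6]; exact u.transition_apply hqv
      have h8 : Φ (v.coord q).1 = (u.coord q).1 := by
        rw [hΦ]; exact congrArg Prod.fst h7
      rw [Function.comp, ← h8, Φ.left_inv h2]
      exact (congrArg Prod.snd h7).symm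
    -- The point of `L'` with parameter `Φ⁻¹` of the first coordinate of `q` has the same
    -- `u`-coordinates as `q`, hence is `q`.
    · intro hq
      have h6 : u.coord (v.chart.symm (c (Φ.symm (u.coord q).1))) = u.coord q := by
        refine Prod.ext ?_ hq.symm
        have : Φ (Φ.symm (u.coord q).1) = (u.coord q).1 := Φ.right_inv h3
        rw [hΦ] at this
        exact this
      rw [← u.coord_injOn h5 hqu h6]
      exact h4
  · rw [Function.comp, hsymm, hval]
  -- Differentiating this identity and using `Dk₂ = P ∘ Dk₁` with `Dk₁` surjective gives `P` as the
  -- derivative of the graph function.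
  · have h1 : k₂ =ᶠ[𝓝 x₀] (k₂ ∘ Φ.symm) ∘ k₁ := by
      filter_upwards [Φ.open_source.mem_nhds hx₀] with x hx
      simp only [Function.comp, ← hΦ, Φ.left_inv hx]
    have h2 : k₁ x₀ = (u.coord p).1 := congrArg Prod.fst hKx
    have h3 := h1.fderiv_eq (𝕜 := ℝ)
    rw [fderiv_comp x₀ (by rw [h2]; exact hf'.self_of_nhds.differentiableAt (by simp))
      (hk₁.self_of_nhds.differentiableAt (by simp)), h2] at h3
    ext1 y
    obtain ⟨b, rfl⟩ := hinv.surjective y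
    have h4 := congrArg (fun T : Eu n →L[ℝ] Eu m => T b) h3
    rw [hd₁, ← hlift, ← hd₂, ← hd₁]
    exact h4

/-- The tangent plane `T_p L` of a pointed submanifold. -/
noncomputable def PointedSubmanifold.tangentPlane (P : PointedSubmanifold n m E) :
    Set (Eu (n + m)) :=
  let u := (P.sub.exists_isGraphAt P.pt P.pt_mem).choose
  u.tangentPlane (P.sub.exists_isGraphAt P.pt P.pt_mem).choose_spec.choose P.pt

theorem PointedSubmanifold.tangentPlane_eq (P : PointedSubmanifold n m E)
    {u : DividedChart n m E} {f : Eu n → Eu m} (hu : u.IsGraphAt P.sub.carrier P.pt f) :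
    P.tangentPlane = u.tangentPlane f P.pt :=
  (P.sub.exists_isGraphAt P.pt P.pt_mem).choose_spec.choose_spec.tangentPlane_eq hu P.pt_mem

theorem HasContact.tangentPlane_eq {r : ℕ} (hr : 1 ≤ r) {P P' : PointedSubmanifold n m E}
    (h : HasContact r P P') : P.tangentPlane = P'.tangentPlane := by
  obtain ⟨hp, u, f, f', hf, hf', hd⟩ := h
  have h1 : fderiv ℝ f (u.coord P.pt).1 = fderiv ℝ f' (u.coord P.pt).1 :=
    JetEq.fderiv_eq hd hr
  rw [P.tangentPlane_eq hf, P'.tangentPlane_eq (hp ▸ hf'), DividedChart.tangentPlane,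
    DividedChart.tangentPlane, h1, hp]

theorem SubJet.tangentPlane_eq_of_mk_eq {r : ℕ} (hr : 1 ≤ r) {P P' : PointedSubmanifold n m E}
    (h : SubJet.mk r P = SubJet.mk r P') : P.tangentPlane = P'.tangentPlane :=
  congrArg (Quot.lift PointedSubmanifold.tangentPlane fun _ _ h => h.tangentPlane_eq hr) h

/-- A contact requires one chart concordant to both submanifolds. Tangency alone provides it, so
point and tangent plane determine the 1-jet. -/
theorem PointedSubmanifold.exists_common_chart {P P' : PointedSubmanifold n m E}
    (hp : P.pt = P'.pt) (ht : P.tangentPlane = P'.tangentPlane) :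
    ∃ (u : DividedChart n m E) (f f' : Eu n → Eu m), u.IsGraphAt P.sub.carrier P.pt f ∧
      u.IsGraphAt P'.sub.carrier P.pt f' ∧ f (u.coord P.pt).1 = f' (u.coord P.pt).1 ∧
      fderiv ℝ f (u.coord P.pt).1 = fderiv ℝ f' (u.coord P.pt).1 := by
  obtain ⟨u, f, hu⟩ := P.sub.exists_isGraphAt P.pt P.pt_mem
  obtain ⟨v, g, hv⟩ := P'.sub.exists_isGraphAt P'.pt P'.pt_mem
  rw [P.tangentPlane_eq hu, P'.tangentPlane_eq hv, ← hp] at ht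
  obtain ⟨f', h⟩ := hu.exists_graph_of_tangentPlane_eq (hp ▸ hv) P.pt_mem (hp ▸ P'.pt_mem) ht
  exact ⟨u, f, f', hu, h⟩

theorem SubJet.mk_one_eq {P P' : PointedSubmanifold n m E} (hp : P.pt = P'.pt)
    (ht : P.tangentPlane = P'.tangentPlane) : SubJet.mk 1 P = SubJet.mk 1 P' := by
  obtain ⟨u, f, f', hf, hf', h0, h1⟩ := P.exists_common_chart hp ht
  exact Quot.sound ⟨hp, u, f, f', hf, hf', iteratedFDeriv_eq_of_le_one h0 h1⟩

/-- The `2`-jet of the pointed submanifold is horizontal, in every divided chart. -/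
def PointedSubmanifold.IsHorizontal (Γ : TorsionFreeConnection (n + m) E)
    (P : PointedSubmanifold n m E) : Prop :=
  ∀ (u : DividedChart n m E) (f : Eu n → Eu m), u.IsGraphAt P.sub.carrier P.pt f →
    ∀ b a : Eu n, dotVertical Γ u P.pt (fderiv ℝ f (u.coord P.pt).1)
      (horLift (fderiv ℝ f (u.coord P.pt).1) b)
      (fderiv ℝ (fderiv ℝ f) (u.coord P.pt).1 b) a = 0

/-- The graph in `u` serves as a parametrization; the criterion in terms of it is the same for `u`
and for any other divided chart. -/
theorem PointedSubmanifold.isHorizontal_of_isGraphAt {Γ : TorsionFreeConnection (n + m) E}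
    {P : PointedSubmanifold n m E} {u : DividedChart n m E} {f : Eu n → Eu m}
    (hu : u.IsGraphAt P.sub.carrier P.pt f)
    (h : ∀ b a : Eu n, dotVertical Γ u P.pt (fderiv ℝ f (u.coord P.pt).1)
      (horLift (fderiv ℝ f (u.coord P.pt).1) b)
      (fderiv ℝ (fderiv ℝ f) (u.coord P.pt).1 b) a = 0) : P.IsHorizontal Γ := by
  intro v g hv
  have hc := hu.isLocalParam P.pt_mem
  rw [hc.dotVertical_eq Γ hv]
  rwa [hc.dotVertical_eq Γ hu] at h

theorem PointedSubmanifold.isHorizontal_of_isLocalParam {Γ : TorsionFreeConnection (n + m) E}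
    {P : PointedSubmanifold n m E} {φ : OpenPartialHomeomorph E (Eu (n + m))}
    {c : Eu n → Eu (n + m)} {x₀ : Eu n} (hc : IsLocalParam φ P.sub.carrier P.pt c x₀)
    (h : ∀ b a, fderiv ℝ (fderiv ℝ c) x₀ b a +
      christoffel Γ φ P.pt (fderiv ℝ c x₀ b) (fderiv ℝ c x₀ a) ∈ range (fderiv ℝ c x₀)) :
    P.IsHorizontal Γ :=
  fun _ _ hu => (hc.dotVertical_eq Γ hu).2 h

theorem HasContact.isHorizontal {Γ : TorsionFreeConnection (n + m) E}
    {P P' : PointedSubmanifold n m E} (h : HasContact 2 P P') (hP : P.IsHorizontal Γ) :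
    P'.IsHorizontal Γ := by
  obtain ⟨hp, u, f, f', hf, hf', hd⟩ := h
  refine PointedSubmanifold.isHorizontal_of_isGraphAt (hp ▸ hf') ?_
  have hd' : JetEq 2 f f' (u.coord P.pt).1 := hd
  rw [← hp, ← hd'.fderiv_eq one_le_two, ← hd'.fderiv_fderiv_eq le_rfl]
  exact hP u f hf

theorem SubJet.isHorizontal_iff_of_mk_eq {Γ : TorsionFreeConnection (n + m) E}
    {P P' : PointedSubmanifold n m E} (h : SubJet.mk 2 P = SubJet.mk 2 P') :
    P.IsHorizontal Γ ↔ P'.IsHorizontal Γ :=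
  iff_of_eq (congrArg (Quot.lift (PointedSubmanifold.IsHorizontal Γ) fun _ _ h =>
    propext ⟨h.isHorizontal, h.symm.isHorizontal⟩) h)

theorem isDotHorizontal_mk_iff {Γ : TorsionFreeConnection (n + m) E}
    {P : PointedSubmanifold n m E} :
    IsDotHorizontal Γ (SubJet.mk 2 P) ↔ P.IsHorizontal Γ := by
  constructor
  · rintro ⟨L, u, f, hL, hu, h⟩
    exact (SubJet.isHorizontal_iff_of_mk_eq hL).1 (PointedSubmanifold.isHorizontal_of_isGraphAt hu h)
  · intro h
    obtain ⟨u, f, hu⟩ := P.sub.exists_isGraphAt P.pt P.pt_mem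
    exact ⟨P, u, f, rfl, hu, h u f hu⟩

/-- The second fundamental form is the vertical form of `Γ̇` evaluated on the `R`-plane, so the two
conditions agree by unfolding. -/
theorem mem_geodesicEquation_iff {Γ : TorsionFreeConnection (n + m) E} {θ : SubJet n m E 2} :
    θ ∈ geodesicEquation Γ ↔ IsDotHorizontal Γ θ :=
  Iff.rfl

/-- The horizontal `2`-jet over a `1`-jet is unique. -/
theorem SubJet.eq_of_isDotHorizontal {Γ : TorsionFreeConnection (n + m) E}
    {θ θ' : SubJet n m E 2} (h : IsDotHorizontal Γ θ) (h' : IsDotHorizontal Γ θ')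
    (heq : SubJet.proj one_le_two θ = SubJet.proj one_le_two θ') : θ = θ' := by
  induction θ using Quot.ind with | mk P =>
  induction θ' using Quot.ind with | mk P' =>
  have heq' : SubJet.mk 1 P = SubJet.mk 1 P' := heq
  have hP := isDotHorizontal_mk_iff.1 h
  have hP' := isDotHorizontal_mk_iff.1 h'
  have hp := SubJet.pt_eq_of_mk_eq heq'
  obtain ⟨u, f, f', hf, hf', h0, h1⟩ :=
    P.exists_common_chart hp (SubJet.tangentPlane_eq_of_mk_eq le_rfl heq')
  refine Quot.sound ⟨hp, u, f, f', hf, hf', jetEq_two h0 h1 ?_⟩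
  ext1 b
  ext1 a
  -- Each equation expresses the second derivative as minus the vertical part of a Christoffel term
  -- which involves only the common 1-jet.
  have h2 := hP u f hf b a
  have h3 := hP' u f' (hp ▸ hf') b a
  rw [← hp, ← h1] at h3
  simp only [dotVertical, vertProj_add] at h2 h3
  simpa [vertProj] using add_right_cancel (h2.trans h3.symm)

end ContactOfSubmanifolds

/-! ### Jets of sections: independence of the charts -/

section JetsOfSections

variable {n m : ℕ} {M E : Type*} [TopologicalSpace M] [ChartedSpace (Eu n) M]
  [TopologicalSpace E] [ChartedSpace (Eu (n + m)) E]

theorem PointedSection.contMDiffAt (s : PointedSection n m M E) :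
    ContMDiffAt (𝓡 n) (𝓡 (n + m)) ∞ s.toFun s.pt :=
  s.contMDiffOn.contMDiffAt (s.isOpen_domain.mem_nhds s.pt_mem)

theorem PointedSection.IsChartPair.congr {s s' : PointedSection n m M E}
    {ψ : OpenPartialHomeomorph M (Eu n)} {φ : OpenPartialHomeomorph E (Eu (n + m))}
    (hc : s.IsChartPair ψ φ) (hp : s.pt = s'.pt) (hv : s.val = s'.val) : s'.IsChartPair ψ φ :=
  ⟨hc.dom_mem, hc.cod_mem, hp ▸ hc.pt_mem, hv ▸ hc.val_mem⟩

theorem PointedSection.localRep_base (s : PointedSection n m M E)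
    {ψ : OpenPartialHomeomorph M (Eu n)} (φ : OpenPartialHomeomorph E (Eu (n + m)))
    (hx : s.pt ∈ ψ.source) : s.localRep ψ φ (ψ s.pt) = φ s.val := by
  simp [localRep, val, ψ.left_inv hx]

theorem PointedSection.tendsto_comp_symm (s : PointedSection n m M E)
    {ψ : OpenPartialHomeomorph M (Eu n)} (hx : s.pt ∈ ψ.source) :
    Tendsto (fun y => s.toFun (ψ.symm y)) (𝓝 (ψ s.pt)) (𝓝 s.val) := by
  have h1 := ψ.symm.continuousAt (ψ.map_source hx)
  rw [ContinuousAt, ψ.left_inv hx] at h1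
  exact s.contMDiffAt.continuousAt.tendsto.comp h1

theorem transition_contDiffAt {k : ℕ} {N : Type*} [TopologicalSpace N] [ChartedSpace (Eu k) N]
    [IsManifold (𝓡 k) ∞ N] {e e' : OpenPartialHomeomorph N (Eu k)}
    (he : e ∈ IsManifold.maximalAtlas (𝓡 k) ∞ N) (he' : e' ∈ IsManifold.maximalAtlas (𝓡 k) ∞ N)
    {p : N} (hp : p ∈ e.source) (hp' : p ∈ e'.source) :
    ContDiffAt ℝ ∞ (e' ∘ e.symm) (e p) := by
  have h1 := contMDiffAt_symm_of_mem_maximalAtlas he (e.map_source hp)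
  have h2 := contMDiffAt_of_mem_maximalAtlas he' hp'
  exact (ContMDiffAt.comp_of_eq (f := e.symm) (g := e') (x := e p) h2 h1
    (e.left_inv hp)).contDiffAt

theorem transition_isInvertible {k : ℕ} {N : Type*} [TopologicalSpace N] [ChartedSpace (Eu k) N]
    [IsManifold (𝓡 k) ∞ N] {e e' : OpenPartialHomeomorph N (Eu k)}
    (he : e ∈ IsManifold.maximalAtlas (𝓡 k) ∞ N) (he' : e' ∈ IsManifold.maximalAtlas (𝓡 k) ∞ N)
    {p : N} (hp : p ∈ e.source) (hp' : p ∈ e'.source) :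
    (fderiv ℝ (e' ∘ e.symm) (e p)).IsInvertible := by
  refine fderiv_transition_isInvertible (e' := e')
    ((contMDiffAt_of_mem_maximalAtlas he hp).mdifferentiableAt (by simp))
    (chart_mfderiv_isInvertible he hp) (chart_mfderiv_isInvertible he' hp')
    ((transition_contDiffAt he he' hp hp').differentiableAt (by simp)) ?_
  filter_upwards [e.open_source.mem_nhds hp] with q hq
  simp [e.left_inv hq]

theorem PointedSection.IsChartPair.contDiffAt_localRep {s : PointedSection n m M E}
    {ψ : OpenPartialHomeomorph M (Eu n)} {φ : OpenPartialHomeomorph E (Eu (n + m))}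
    (hc : s.IsChartPair ψ φ) : ContDiffAt ℝ ∞ (s.localRep ψ φ) (ψ s.pt) := by
  have h1 := contMDiffAt_symm_of_mem_maximalAtlas hc.dom_mem (ψ.map_source hc.pt_mem)
  have h2 : ContMDiffAt (𝓡 n) (𝓡 (n + m)) ∞ (s.toFun ∘ ψ.symm) (ψ s.pt) :=
    ContMDiffAt.comp_of_eq s.contMDiffAt h1 (ψ.left_inv hc.pt_mem)
  exact (ContMDiffAt.comp_of_eq (contMDiffAt_of_mem_maximalAtlas hc.cod_mem hc.val_mem) h2
    (congrArg s.toFun (ψ.left_inv hc.pt_mem))).contDiffAt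

theorem PointedSection.IsChartPair.eventually_contDiffAt_localRep {s : PointedSection n m M E}
    {ψ : OpenPartialHomeomorph M (Eu n)} {φ : OpenPartialHomeomorph E (Eu (n + m))}
    (hc : s.IsChartPair ψ φ) : ∀ᶠ y in 𝓝 (ψ s.pt), ContDiffAt ℝ ∞ (s.localRep ψ φ) y := by
  have h1 := ψ.symm.continuousAt (ψ.map_source hc.pt_mem)
  rw [ContinuousAt, ψ.left_inv hc.pt_mem] at h1
  filter_upwards [h1.eventually (s.isOpen_domain.mem_nhds s.pt_mem),
    (s.tendsto_comp_symm hc.pt_mem).eventually (φ.open_source.mem_nhds hc.val_mem),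
    ψ.open_target.mem_nhds (ψ.map_source hc.pt_mem)] with y h2 h3 h4
  -- The same section with its base point moved reduces smoothness nearby to smoothness at the base
  -- point.
  let s' : PointedSection n m M E := { s with pt := ψ.symm y, pt_mem := h2 }
  have hc' : s'.IsChartPair ψ φ := ⟨hc.dom_mem, hc.cod_mem, ψ.map_target h4, h3⟩
  have h5 := hc'.contDiffAt_localRep
  rwa [show ψ s'.pt = y from ψ.right_inv h4] at h5

theorem PointedSection.IsChartPair.localRep_eventuallyEq {s : PointedSection n m M E}
    {ψ ψ' : OpenPartialHomeomorph M (Eu n)} {φ φ' : OpenPartialHomeomorph E (Eu (n + m))}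
    (hc : s.IsChartPair ψ φ) (hc' : s.IsChartPair ψ' φ') :
    s.localRep ψ' φ' =ᶠ[𝓝 (ψ' s.pt)]
      (φ' ∘ φ.symm) ∘ s.localRep ψ φ ∘ (ψ ∘ ψ'.symm) := by
  have h1 := ψ'.symm.continuousAt (ψ'.map_source hc'.pt_mem)
  rw [ContinuousAt, ψ'.left_inv hc'.pt_mem] at h1
  filter_upwards [h1.eventually (ψ.open_source.mem_nhds hc.pt_mem),
    (s.tendsto_comp_symm hc'.pt_mem).eventually (φ.open_source.mem_nhds hc.val_mem)] with y h2 h3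
  simp [localRep, ψ.left_inv h2, φ.left_inv h3]

/-- An immersion maps a small neighbourhood of the point onto a submanifold which it parametrizes. -/
theorem PointedSection.isLocalParam_localRep (s : PointedSection n m M E)
    {ψ : OpenPartialHomeomorph M (Eu n)}
    {φ : OpenPartialHomeomorph E (Eu (n + m))} (hc : s.IsChartPair ψ φ)
    (hi : Function.Injective (fderiv ℝ (s.localRep ψ φ) (ψ s.pt)))
    {U : Set M} (hU : IsOpen U) (hp : s.pt ∈ U) :
    IsLocalParam φ (s.toFun '' U) s.val (s.localRep ψ φ) (ψ s.pt) := by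
  refine ⟨hc.cod_mem, hc.val_mem, hc.contDiffAt_localRep.of_le (by exact_mod_cast two_le_infty),
    s.localRep_base φ hc.pt_mem, hi, ?_⟩
  have h1 := ψ.symm.continuousAt (ψ.map_source hc.pt_mem)
  rw [ContinuousAt, ψ.left_inv hc.pt_mem] at h1
  filter_upwards [h1.eventually (hU.mem_nhds hp),
    (s.tendsto_comp_symm hc.pt_mem).eventually (φ.open_source.mem_nhds hc.val_mem)] with y h2 h3
  exact ⟨_, h2, (φ.left_inv h3).symm⟩

variable [IsManifold (𝓡 n) ∞ M] [IsManifold (𝓡 (n + m)) ∞ E]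

/-- Passing to other charts composes both local representatives with the same transition maps, and
composition respects equality of jets. -/
theorem HasSameJet.jetEq {r : ℕ} {s s' : PointedSection n m M E} (h : HasSameJet r s s')
    {ψ' : OpenPartialHomeomorph M (Eu n)} {φ' : OpenPartialHomeomorph E (Eu (n + m))}
    (hc' : s.IsChartPair ψ' φ') :
    JetEq r (s.localRep ψ' φ') (s'.localRep ψ' φ') (ψ' s.pt) := by
  obtain ⟨hp, hv, ψ, φ, hc, hd⟩ := h
  have hs := hc.contDiffAt_localRep
  have hs' := (hc.congr hp hv).contDiffAt_localRep
  have hβ := transition_contDiffAt hc'.dom_mem hc.dom_mem hc'.pt_mem hc.pt_mem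
  have hα := transition_contDiffAt hc.cod_mem hc'.cod_mem hc.val_mem hc'.val_mem
  have hβx : (ψ ∘ ψ'.symm) (ψ' s.pt) = ψ s.pt := by simp [ψ'.left_inv hc'.pt_mem]
  have hr : ((r : ℕ) : WithTop ℕ∞) ≤ ∞ := by exact_mod_cast le_top
  have hcongr' := (hc.congr hp hv).localRep_eventuallyEq (hc'.congr hp hv)
  rw [← hp] at hs' hcongr'
  refine JetEq.congr ?_ (hc.localRep_eventuallyEq hc').symm hcongr'.symm
  have h1 : JetEq r (s.localRep ψ φ ∘ (ψ ∘ ψ'.symm)) (s'.localRep ψ φ ∘ (ψ ∘ ψ'.symm))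
      (ψ' s.pt) := by
    refine JetEq.comp ?_ ?_ (hβ.of_le hr) (hβ.of_le hr) ?_ fun _ _ => rfl
    · rw [hβx]; exact hs.of_le hr
    · rw [hβx]; exact hs'.of_le hr
    · rw [hβx]; exact hd
  have hval : (s.localRep ψ φ ∘ (ψ ∘ ψ'.symm)) (ψ' s.pt) = φ s.val := by
    rw [Function.comp, hβx, s.localRep_base φ hc.pt_mem]
  refine JetEq.comp ?_ ?_ ?_ ?_ (fun _ _ => rfl) h1
  · rw [hval]; exact hα.of_le hr
  · rw [hval]; exact hα.of_le hr
  · exact (ContDiffAt.comp _ (by rw [hβx]; exact hs) hβ).of_le hr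
  · exact (ContDiffAt.comp _ (by rw [hβx]; exact hs') hβ).of_le hr

/-- Equality in the quotient means the generated equivalence relation. Quantifying over all chart
pairs makes the conclusion transitive, so it survives each generating step. -/
theorem SecJet.jetEq_of_mk_eq {r : ℕ} {s s' : PointedSection n m M E}
    (h : SecJet.mk r s = SecJet.mk r s') : s.pt = s'.pt ∧ s.val = s'.val ∧
      ∀ (ψ : OpenPartialHomeomorph M (Eu n)) (φ : OpenPartialHomeomorph E (Eu (n + m))),
        s.IsChartPair ψ φ → JetEq r (s.localRep ψ φ) (s'.localRep ψ φ) (ψ s.pt) := by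
  have hE := Quot.eqvGen_exact h
  clear h
  induction hE with
  | rel s s' h => exact ⟨h.1, h.2.1, fun _ _ => h.jetEq⟩
  | refl s => exact ⟨rfl, rfl, fun _ _ _ _ _ => rfl⟩
  | symm s s' _ ih =>
    obtain ⟨h1, h2, h3⟩ := ih
    refine ⟨h1.symm, h2.symm, fun ψ φ hc k hk => ?_⟩
    rw [← h1]
    exact (h3 ψ φ (hc.congr h1.symm h2.symm) k hk).symm
  | trans s s' s'' _ _ ih ih' =>
    obtain ⟨h1, h2, h3⟩ := ih
    obtain ⟨h1', h2', h3'⟩ := ih'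
    refine ⟨h1.trans h1', h2.trans h2', fun ψ φ hc k hk => ?_⟩
    refine (h3 ψ φ hc k hk).trans ?_
    rw [h1]
    exact h3' ψ φ (hc.congr h1 h2) k hk

theorem PointedSection.IsChartPair.injective_fderiv {s : PointedSection n m M E}
    {ψ ψ' : OpenPartialHomeomorph M (Eu n)} {φ φ' : OpenPartialHomeomorph E (Eu (n + m))}
    (hc : s.IsChartPair ψ φ) (hc' : s.IsChartPair ψ' φ')
    (hi : Function.Injective (fderiv ℝ (s.localRep ψ φ) (ψ s.pt))) :
    Function.Injective (fderiv ℝ (s.localRep ψ' φ') (ψ' s.pt)) := by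
  have hβ := transition_contDiffAt hc'.dom_mem hc.dom_mem hc'.pt_mem hc.pt_mem
  have hα := transition_contDiffAt hc.cod_mem hc'.cod_mem hc.val_mem hc'.val_mem
  have hβx : (ψ ∘ ψ'.symm) (ψ' s.pt) = ψ s.pt := by simp [ψ'.left_inv hc'.pt_mem]
  have hs : ContDiffAt ℝ ∞ (s.localRep ψ φ) ((ψ ∘ ψ'.symm) (ψ' s.pt)) := by
    rw [hβx]; exact hc.contDiffAt_localRep
  have hval : (s.localRep ψ φ ∘ (ψ ∘ ψ'.symm)) (ψ' s.pt) = φ s.val := by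
    rw [Function.comp, hβx, s.localRep_base φ hc.pt_mem]
  rw [(hc.localRep_eventuallyEq hc').fderiv_eq, fderiv_comp _
    (by rw [hval]; exact hα.differentiableAt (by simp))
    ((hs.comp _ hβ).differentiableAt (by simp)), hval,
    fderiv_comp _ (hs.differentiableAt (by simp)) (hβ.differentiableAt (by simp)), hβx]
  exact (transition_isInvertible hc.cod_mem hc'.cod_mem hc.val_mem hc'.val_mem).injective.comp
    (hi.comp (transition_isInvertible hc'.dom_mem hc.dom_mem hc'.pt_mem hc.pt_mem).injective)

/-- In its normal-form charts an immersion is the linear injection `y ↦ (y, 0)` up to a linear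
equivalence; other charts only add invertible factors. -/
theorem PointedSection.IsImmersion.injective_fderiv {s : PointedSection n m M E}
    (hs : s.IsImmersion) {ψ : OpenPartialHomeomorph M (Eu n)}
    {φ : OpenPartialHomeomorph E (Eu (n + m))} (hc : s.IsChartPair ψ φ) :
    Function.Injective (fderiv ℝ (s.localRep ψ φ) (ψ s.pt)) := by
  have h := hs s.pt s.pt_mem
  have hc₀ : s.IsChartPair h.domChart h.codChart :=
    ⟨h.domChart_mem_maximalAtlas, h.codChart_mem_maximalAtlas, h.mem_domChart_source,
      h.mem_codChart_source⟩
  refine hc₀.injective_fderiv hc ?_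
  let ι : Eu n →L[ℝ] Eu (n + m) :=
    (h.equiv : Eu n × h.complement →L[ℝ] Eu (n + m)) ∘L ContinuousLinearMap.inl ℝ _ _
  have heq : s.localRep h.domChart h.codChart =ᶠ[𝓝 (h.domChart s.pt)] ι := by
    filter_upwards [h.domChart.open_target.mem_nhds (h.domChart.map_source h.mem_domChart_source)]
      with y hy
    have := h.writtenInCharts (show y ∈ (h.domChart.extend (𝓡 n)).target by
      rw [OpenPartialHomeomorph.extend_target]; simpa using hy)
    simpa [localRep, ι] using this
  rw [heq.fderiv_eq, ι.fderiv]
  intro a b hab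
  exact congrArg Prod.fst (h.equiv.injective hab)

end JetsOfSections

/-! ### Immersions recognized by their 1-jets -/

section Immersions

variable {n m : ℕ}

theorem exists_complement {A : Eu n →L[ℝ] Eu (n + m)} (hA : Function.Injective A) :
    ∃ B : Eu m →L[ℝ] Eu (n + m), (A.coprod B).IsInvertible := by
  obtain ⟨q, hq⟩ := Submodule.exists_isCompl (A : Eu n →ₗ[ℝ] Eu (n + m)).range
  have hr : Module.finrank ℝ (A : Eu n →ₗ[ℝ] Eu (n + m)).range = n := by
    rw [LinearMap.finrank_range_of_inj hA]; simp
  have hd : Module.finrank ℝ (Eu m) = Module.finrank ℝ q := by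
    have := Submodule.finrank_add_eq_of_isCompl hq
    simp only [finrank_euclideanSpace, Fintype.card_fin] at this ⊢
    omega
  let g : Eu m ≃L[ℝ] q := ContinuousLinearEquiv.ofFinrankEq hd
  refine ⟨q.subtypeL ∘L g, isInvertible_of_injective (by simp) ?_⟩
  rw [injective_iff_map_eq_zero]
  rintro ⟨a, b⟩ h
  have h1 : A a + (g b : Eu (n + m)) = 0 := by simpa using h
  have h2 : (g b : Eu (n + m)) = 0 := by
    refine Submodule.disjoint_def.1 hq.disjoint _ ⟨-a, ?_⟩ (g b).2
    exact (map_neg A a).trans (neg_eq_of_add_eq_zero_right h1)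
  have h3 : b = 0 := by simpa using h2
  have h4 : a = 0 := hA (by simpa [h2] using h1)
  rw [h3, h4]; rfl

variable {M E : Type*} [TopologicalSpace M] [ChartedSpace (Eu n) M]
  [TopologicalSpace E] [ChartedSpace (Eu (n + m)) E]
  [IsManifold (𝓡 (n + m)) ∞ E]

/-- A section whose differential at the given point is injective is an immersion there. -/
theorem PointedSection.IsChartPair.isImmersionAt {s : PointedSection n m M E}
    {ψ : OpenPartialHomeomorph M (Eu n)} {φ : OpenPartialHomeomorph E (Eu (n + m))}
    (hc : s.IsChartPair ψ φ)
    (hi : Function.Injective (fderiv ℝ (s.localRep ψ φ) (ψ s.pt))) :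
    IsImmersionAt (𝓡 n) (𝓡 (n + m)) ∞ s.toFun s.pt := by
  set c := s.localRep ψ φ
  set x₀ := ψ s.pt
  obtain ⟨B, hB⟩ := exists_complement hi
  -- Adding a linear complement to the image of `Dc` extends `c` to a local diffeomorphism; its
  -- inverse straightens the image of `c` to `y ↦ (y, 0)`.
  let Ψ : Eu n × Eu m → Eu (n + m) := fun z => c z.1 + B z.2
  have hΨ : ∀ᶠ z in 𝓝 (x₀, (0 : Eu m)), ContDiffAt ℝ ∞ Ψ z := by
    have h1 : Tendsto Prod.fst (𝓝 (x₀, (0 : Eu m))) (𝓝 x₀) := continuous_fst.tendsto _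
    filter_upwards [h1.eventually hc.eventually_contDiffAt_localRep] with z hz
    exact (hz.comp z contDiffAt_fst).add (B.contDiff.contDiffAt.comp z contDiffAt_snd)
  have hdΨ : fderiv ℝ Ψ (x₀, 0) = (fderiv ℝ c x₀).coprod B := by
    have h1 : HasFDerivAt c (fderiv ℝ c x₀) x₀ :=
      (hc.contDiffAt_localRep.differentiableAt (by simp)).hasFDerivAt
    have h2 : HasFDerivAt Ψ (fderiv ℝ c x₀ ∘L ContinuousLinearMap.fst ℝ (Eu n) (Eu m) +
        B ∘L ContinuousLinearMap.snd ℝ (Eu n) (Eu m)) (x₀, 0) :=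
      (HasFDerivAt.comp (x₀, (0 : Eu m)) (f := Prod.fst) h1 hasFDerivAt_fst).add
        (B.hasFDerivAt.comp (x₀, (0 : Eu m)) hasFDerivAt_snd)
    rw [h2.fderiv]
    ext z <;> simp
  obtain ⟨Φ, hx₀, hΦ, hΦs, hΦt⟩ := exists_openPartialHomeomorph hΨ (hdΨ ▸ hB)
  obtain ⟨e, -⟩ := hB
  -- The equivalence `e` only identifies the product with the model space: in the chart `e ∘ Φ⁻¹ ∘
  -- φ` the section is `y ↦ e (y, 0)`.
  let φ' : OpenPartialHomeomorph E (Eu (n + m)) :=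
    (φ.trans Φ.symm).transHomeomorph e.toHomeomorph
  have hφ' : φ' ∈ IsManifold.maximalAtlas (𝓡 (n + m)) ∞ E := by
    refine φ'.mem_maximalAtlas_of_contMDiffOn (fun q hq => ?_) (fun y hy => ?_)
    · have hq' : q ∈ φ.source ∧ φ q ∈ Φ.target := by simpa [φ'] using hq
      have h1 : ContDiffAt ℝ ∞ (e ∘ Φ.symm) (φ q) :=
        e.contDiff.contDiffAt.comp _ (hΦt _ hq'.2)
      exact (h1.contMDiffAt.comp q
        (contMDiffAt_of_mem_maximalAtlas hc.cod_mem hq'.1)).contMDiffWithinAt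
    · have hy' : e.symm y ∈ Φ.source ∧ Φ (e.symm y) ∈ φ.target := by simpa [φ'] using hy
      have h1 : ContDiffAt ℝ ∞ (Φ ∘ e.symm) y := by
        rw [hΦ]
        exact (hΦs _ hy'.1).comp _ e.symm.contDiff.contDiffAt
      exact ((contMDiffAt_symm_of_mem_maximalAtlas hc.cod_mem hy'.2).comp y
        h1.contMDiffAt).contMDiffWithinAt
  let S : Set M := ψ.source ∩ ψ ⁻¹' ((fun y => (y, (0 : Eu m))) ⁻¹' Φ.source)
  have hS : IsOpen S := ψ.isOpen_inter_preimage (Φ.open_source.preimage (by fun_prop))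
  have hpS : s.pt ∈ S := ⟨hc.pt_mem, hx₀⟩
  refine (IsImmersionAtOfComplement.mk_of_continuousAt (F := Eu m) s.contMDiffAt.continuousAt e
    (ψ.restr S) φ' ?_ ?_ (restr_mem_maximalAtlas _ hc.dom_mem hS) hφ' ?_).isImmersionAt
  · rw [ψ.restr_source' S hS]
    exact ⟨hc.pt_mem, hpS⟩
  · have h1 : Φ (x₀, 0) = φ s.val := by
      rw [hΦ]
      simp only [Ψ, map_zero, add_zero]
      exact s.localRep_base φ hc.pt_mem
    have h2 : φ s.val ∈ Φ.target := h1 ▸ Φ.map_source hx₀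
    simpa [φ'] using ⟨hc.val_mem, h2⟩
  · intro y hy
    rw [OpenPartialHomeomorph.extend_target] at hy
    have h1 : y ∈ (ψ.restr S).target := by simpa using hy
    have h2 := (ψ.restr S).map_target h1
    rw [ψ.restr_source' S hS] at h2
    have h3 : y ∈ ψ.target := by
      have := h1.1
      simpa using this
    have h4 : (y, (0 : Eu m)) ∈ Φ.source := by
      have := h2.2.2
      simpa [ψ.right_inv h3] using this
    have h5 : φ (s.toFun (ψ.symm y)) = Φ (y, 0) := by
      rw [hΦ]
      simp [Ψ, c, localRep]
    simp [φ', h5, Φ.left_inv h4]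

variable [IsManifold (𝓡 n) ∞ M]

theorem PointedSection.exists_isChartPair (s : PointedSection n m M E) :
    ∃ (ψ : OpenPartialHomeomorph M (Eu n)) (φ : OpenPartialHomeomorph E (Eu (n + m))),
      s.IsChartPair ψ φ :=
  ⟨chartAt _ s.pt, chartAt _ s.val, IsManifold.chart_mem_maximalAtlas _,
    IsManifold.chart_mem_maximalAtlas _, mem_chart_source _ _, mem_chart_source _ _⟩

/-- `IsImmersion` concerns the whole domain. Being an immersion at a point is an open condition, so
the domain can be shrunk without changing the jet. -/
theorem SecJet.mk_mem_immJet {r : ℕ} (s : PointedSection n m M E)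
    (h : IsImmersionAt (𝓡 n) (𝓡 (n + m)) ∞ s.toFun s.pt) : SecJet.mk r s ∈ ImmJet n m M E r := by
  let s' : PointedSection n m M E :=
    { domain := s.domain ∩ {x | IsImmersionAt (𝓡 n) (𝓡 (n + m)) ∞ s.toFun x}
      isOpen_domain := s.isOpen_domain.inter .isImmersionAt
      toFun := s.toFun
      contMDiffOn := s.contMDiffOn.mono inter_subset_left
      pt := s.pt
      pt_mem := ⟨s.pt_mem, h⟩ }
  obtain ⟨ψ, φ, hc⟩ := s.exists_isChartPair
  exact ⟨s', fun x hx => hx.2, Quot.sound ⟨rfl, rfl, ψ, φ,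
    ⟨hc.dom_mem, hc.cod_mem, hc.pt_mem, hc.val_mem⟩, fun _ _ => rfl⟩⟩

end Immersions

/-! ### Prolongation of jets of immersions -/

section Prolongation

variable {n m : ℕ} {M E : Type*} [TopologicalSpace M] [ChartedSpace (Eu n) M]
  [TopologicalSpace E] [ChartedSpace (Eu (n + m)) E]

theorem prolong_spec {r : ℕ} (θ : ImmJet n m M E r) : IsProlongation r θ.1 (prolong r θ) :=
  (exists_prolongation r θ).choose_spec

variable [IsManifold (𝓡 n) ∞ M] [IsManifold (𝓡 (n + m)) ∞ E]

/-- The prolongation of the `1`-jet of an immersion does not depend on the choices. -/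
theorem IsProlongation.proj_eq {r : ℕ} (hr : 1 ≤ r) {θ : SecJet n m M E r} {θ' : SecJet n m M E 1}
    {η : SubJet n m E r} {η' : SubJet n m E 1} (h : IsProlongation r θ η)
    (h' : IsProlongation 1 θ' η') (heq : SecJet.proj hr θ = θ') : SubJet.proj hr η = η' := by
  obtain ⟨s, U, L, hs, rfl, hU, hpU, -, hL, hpt, rfl⟩ := h
  obtain ⟨s', U', L', hs', rfl, hU', hpU', -, hL', hpt', rfl⟩ := h'
  obtain ⟨hp, hv, hd⟩ := SecJet.jetEq_of_mk_eq (r := 1) (s := s) (s' := s') heq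
  obtain ⟨ψ, φ, hc⟩ := s.exists_isChartPair
  have hc' := hc.congr hp hv
  have h1 := s.isLocalParam_localRep hc (hs.injective_fderiv hc) hU hpU
  have h1' := s'.isLocalParam_localRep hc' (hs'.injective_fderiv hc') hU' hpU'
  rw [← hL, ← hpt] at h1
  rw [← hL', ← hpt'] at h1'
  have hLL : L.pt = L'.pt := hpt.trans (hv.trans hpt'.symm)
  have hdd := (hd _ _ hc).fderiv_eq le_rfl
  refine SubJet.mk_one_eq (P := L) hLL ?_
  obtain ⟨u, f, hu⟩ := L.sub.exists_isGraphAt L.pt L.pt_mem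
  obtain ⟨v, g, hv'⟩ := L'.sub.exists_isGraphAt L'.pt L'.pt_mem
  rw [L.tangentPlane_eq hu, L'.tangentPlane_eq hv']
  ext y
  -- Both tangent planes are the range of the same differential, since the two sections have equal
  -- 1-jets.
  rw [h1.mem_tangentPlane_iff hu, h1'.mem_tangentPlane_iff hv', ← hp, hdd, hLL]

/-- The prolongation of a horizontal `2`-jet is horizontal. -/
theorem IsProlongation.isDotHorizontal {Γ : TorsionFreeConnection (n + m) E}
    {Θ : TorsionFreeConnection n M} {θ : SecJet n m M E 2} {η : SubJet n m E 2}
    (h : IsProlongation 2 θ η) (hθ : IsDotHorizontalSec Γ Θ θ) : IsDotHorizontal Γ η := by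
  obtain ⟨s, U, L, hs, hsθ, hU, hpU, -, hL, hpt, rfl⟩ := h
  obtain ⟨s', ψ, φ, hsθ', hc', hh⟩ := hθ
  -- The section witnessing horizontality and the immersion used for the prolongation may differ;
  -- their derivatives up to order two agree.
  obtain ⟨hp, hv, hd⟩ := SecJet.jetEq_of_mk_eq (hsθ'.trans hsθ.symm)
  have hj := hd ψ φ hc'
  have hc := hc'.congr hp hv
  have h1 := s.isLocalParam_localRep hc (hs.injective_fderiv hc) hU hpU
  rw [← hL, ← hpt] at h1
  refine isDotHorizontal_mk_iff.2 (PointedSubmanifold.isHorizontal_of_isLocalParam h1 fun b a => ?_)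
  have h2 := hh b a
  rw [hj.fderiv_eq one_le_two, hj.fderiv_fderiv_eq le_rfl, hv, hp, ← hpt] at h2
  -- The preimage under `Dc` is the Christoffel term of `Θ` at `(b, a)`.
  exact ⟨_, (sub_eq_zero.1 h2).symm⟩

theorem mem_geodesicEquationSec_iff {Γ : TorsionFreeConnection (n + m) E}
    {Θ : TorsionFreeConnection n M} {θ : ImmJet n m M E 2} :
    θ ∈ geodesicEquationSec Γ Θ ↔ IsDotHorizontalSec Γ Θ θ.1 :=
  Iff.rfl

/-- A jet over the `1`-jet of an immersion is the jet of an immersion. -/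
theorem SecJet.mem_immJet_of_proj {r : ℕ} (hr : 1 ≤ r) {θ : SecJet n m M E r}
    (h : SecJet.proj hr θ ∈ ImmJet n m M E 1) : θ ∈ ImmJet n m M E r := by
  induction θ using Quot.ind with | mk s =>
  obtain ⟨s', hs', heq⟩ := h
  obtain ⟨hp, hv, hd⟩ := SecJet.jetEq_of_mk_eq (r := 1) (s := s') (s' := s) heq
  obtain ⟨ψ, φ, hc⟩ := s'.exists_isChartPair
  have hi := hs'.injective_fderiv hc
  rw [(hd _ _ hc).fderiv_eq le_rfl, hp] at hi
  exact SecJet.mk_mem_immJet s ((hc.congr hp hv).isImmersionAt hi)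

end Prolongation

end JetSubmfd

theorem mainTheorem9 {n m : ℕ} {M E : Type*}
    [TopologicalSpace M] [ChartedSpace (JetSubmfd.Eu n) M] [IsManifold (𝓡 n) ∞ M]
    [TopologicalSpace E] [ChartedSpace (JetSubmfd.Eu (n + m)) E] [IsManifold (𝓡 (n + m)) ∞ E]
    (Γ : JetSubmfd.TorsionFreeConnection (n + m) E)
    (Θ : JetSubmfd.TorsionFreeConnection n M) :
    (∀ θ : JetSubmfd.ImmJet n m M E 1,
      ∃ h : JetSubmfd.ddotGammaSec Γ Θ θ.1 ∈ JetSubmfd.ImmJet n m M E 2,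
        JetSubmfd.prolong 2 ⟨JetSubmfd.ddotGammaSec Γ Θ θ.1, h⟩ =
          JetSubmfd.ddotGamma Γ (JetSubmfd.prolong 1 θ)) ∧
    (∀ θ ∈ JetSubmfd.geodesicEquationSec (m := m) Γ Θ,
      JetSubmfd.prolong 2 θ ∈ JetSubmfd.geodesicEquation Γ) := by
  open JetSubmfd in
  refine ⟨fun θ => ?_, fun θ hθ => ?_⟩
  · obtain ⟨h1, h2⟩ := ddotGammaSec_spec Γ Θ θ.1
    obtain ⟨h3, h4⟩ := ddotGamma_spec Γ (prolong 1 θ)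
    have hmem : ddotGammaSec Γ Θ θ.1 ∈ ImmJet n m M E 2 :=
      SecJet.mem_immJet_of_proj one_le_two (by rw [h1]; exact θ.2)
    -- Both 2-jets are horizontal, so only their projections to `J¹(E,n)` remain to be compared.
    refine ⟨hmem, SubJet.eq_of_isDotHorizontal ((prolong_spec _).isDotHorizontal h2) h4 ?_⟩
    rw [h3]
    exact (prolong_spec _).proj_eq one_le_two (prolong_spec θ) h1
  · exact mem_geodesicEquation_iff.2
      ((prolong_spec θ).isDotHorizontal (mem_geodesicEquationSec_iff.1 hθ))
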